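/- **Scenarios and behaviors.** A compatibility scenario $\Upsilon=(\mathcal M,\mathcal C,\mathcal O)$ consists of a finite set $\mathcal M$ of measurements, an antichain $\mathcal C$ of subsets of $\mathcal M$ (maximal contexts) and a finite nonempty outcome set $\mathcal O^x$ for each $x\in\mathcal M$; $\mathcal O^\gamma=\prod_{x\in\gamma}\mathcal O^x$. A behavior is a family $B=(p_\gamma)_{\gamma\in\mathcal C}$ of probability distributions $p_\gamma$ on $\mathcal O^\gamma$. $\mathrm{ND}(\Upsilon)$ is the set of nondisturbing behaviors ($p_\gamma$, $p_{\gamma'}$ have the same marginal on $\gamma\cap\gamma'$), and $\mathrm{NC}(\Upsilon)$ is the set of noncontextual ones (all $p_\gamma$ are marginals of one distribution on $\mathcal O^{\mathcal M}$). **Noncontextual wirings (NCW).** A noncontextual wiring from $\Upsilon$ to $\Upsilon'=(\mathcal M',\mathcal C',\mathcal O')$ is a map $$B=(p_\gamma)\longmapsto \mathcal W(B)_\beta(t)=\sum_{r}p_\beta(r)\sum_{s\in\mathcal O^{f_\beta(r)}}p_{f_\beta(r)}(s)\,p_{\delta=g(s|r,\beta)}(t),\qquad \beta\in\mathcal C',\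 t\in\mathcal O'^\beta,$$ where: (1) $(p_\beta(r))$ is a noncontextual behavior in some scenario with measurements $\mathcal M'$ and contexts $\mathcal C'$, $f_\beta(r)\in\mathcal C$, and each component $\beta_i\in\beta$ is passed the outcome $s_i$ of one measurement in $f_\beta(r)$, which whenever $p_\beta(r)\neq0$ depends on $(\beta_i,r_i)$ only; (2) for each $(r,\beta)$, $(p_\delta)$ is a noncontextual behavior in some scenario $\Upsilon^{(r,\beta)}_{POS}$, and $g(s|r,\beta)=\bigcup_i\{g_i(s_i|r,\beta)\}$ is one of its maximal contexts, the outcome of $g_i(s_i|r,\beta)$ being read as an outcome $t_i\in\mathcal O'^{\beta_i}$; (3) the adaptivity respects factorizability: there are a finite probability distribution $p(\phi)$ and response functions with $p_{\delta=g(s|r,\beta)}(t)=\sum_\phi p(\phi)\prod_i p(t_i\,|\,\phi,\beta_i,r_i,s_i)$ for all $\beta,r,s,t$ (where $s_i$ comes together with the label of the measurement that yielded it). The objects are the pairs $(\Upsilon,B)$ with $B\in\mathrm{ND}(\Upsilon)$, and $X\to Y$ means that some noncontextual wiring takes $X$ to $Y$. A chain is a set of objects in which any two distinct elements $X,Y$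 are strictly ordered (exactly one of $X\to Y$, $Y\to X$ holds); an antichain is one in which any two distinct elements are incomparable (neither holds). The height (width) is the supremum of the cardinalities of chains (antichains). **Cycles.** For $n\ge3$ let $\Upsilon_n$ have measurements $x_i$ ($i\in\mathbb Z/n$), outcomes $\{0,1\}$ and contexts $\{x_i,x_{i+1}\}$. For signs $a_i\in\{1,-1\}$ with an odd number equal to $-1$ (the choice of signs is labelled $k$), put $I_k^{(n)}(B)=\sum_i a_i\langle x_ix_{i+1}\rangle$, where $\langle x_ix_{i+1}\rangle=p(00)+p(11)-p(01)-p(10)$. Let $B_\varnothing$ be the behavior with all joint outcomes in each context equally likely, and let $\mathrm{NDC}(\Upsilon_n)$ be the set of vertices of $\mathrm{ND}(\Upsilon_n)$ that are not vertices of $\mathrm{NC}(\Upsilon_n)$. **Theorem.** The height and the width of the pre-order on objects induced by NCW are both uncountably infinite. More precisely, for every $n\ge 3$ and every $k$: 1. There is a unique $B_k\in\mathrm{NDC}(\Upsilon_n)$ with $I_k^{(n)}(B_k)=n$. With $B_k'=\frac{n-2}{n}B_k+\frac2nB_\varnothing$ and $B_\varepsilon=\varepsilon B_k+(1-\varepsilon)B_k'$,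 the segment $P_k^{(n)}=\{B_\varepsilon:0\le\varepsilon\le1\}$ consists of nondisturbing behaviors, has the cardinality of the continuum, and is a chain. 2. There is a vertex $\tilde B$ of $\mathrm{NC}(\Upsilon_n)$ with $I_k^{(n)}(\tilde B)=n-2$. For every such $\tilde B$, with $B(\alpha,\varepsilon)=\alpha\tilde B+(1-\alpha)B_\varepsilon$, the segment $\{B(x,x):\frac12\le x<1\}$ consists of nondisturbing behaviors, has the cardinality of the continuum, and is an antichain. -/

import Mathlib

open scoped Cardinal

noncomputable section

namespace KSContextuality

/-! ### Compatibility scenarios and behaviors -/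

/-- A compatibility scenario: a finite set of measurements, an antichain of maximal contexts,
and a finite nonempty outcome set for each measurement. -/
structure Scenario : Type 1 where
  M : Type
  [fintypeM : Fintype M]
  [decEqM : DecidableEq M]
  contexts : Finset (Finset M)
  maximal : ∀ γ ∈ contexts, ∀ γ' ∈ contexts, γ ⊆ γ' → γ = γ'
  O : M → Type
  [fintypeO : ∀ x, Fintype (O x)]
  [decEqO : ∀ x, DecidableEq (O x)]
  [nonemptyO : ∀ x, Nonempty (O x)]

attribute [instance] Scenario.fintypeM Scenario.decEqM Scenario.fintypeO Scenario.decEqO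
  Scenario.nonemptyO

/-- The maximal contexts of a scenario, as a type. -/
abbrev Scenario.Context (Υ : Scenario) : Type := {γ : Finset Υ.M // γ ∈ Υ.contexts}

/-- Joint outcomes of a set `γ` of measurements. -/
abbrev Scenario.Outcomes (Υ : Scenario) (γ : Finset Υ.M) : Type := ∀ x : {x // x ∈ γ}, Υ.O x

/-- Real tables `p_γ(s)`, indexed by the maximal contexts `γ` and the joint outcomes `s`. -/
abbrev Scenario.Table (Υ : Scenario) : Type := ∀ γ : Υ.Context, Υ.Outcomes γ.1 → ℝ

/-- The scenario with the measurements and contexts of `Υ`, and outcome sets `R`. -/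
abbrev Scenario.withOutcomes (Υ : Scenario) (R : Υ.M → Type) [∀ x, Fintype (R x)]
    [∀ x, DecidableEq (R x)] [∀ x, Nonempty (R x)] : Scenario where
  M := Υ.M
  contexts := Υ.contexts
  maximal := Υ.maximal
  O := R

/-- A behavior: one probability distribution for each maximal context. -/
def IsBehavior {Υ : Scenario} (B : Υ.Table) : Prop :=
  ∀ γ, (∀ s, 0 ≤ B γ s) ∧ ∑ s, B γ s = 1

/-- The marginal of `p_γ` on a subset `η` of the context `γ`. -/
def marginal {Υ : Scenario} (B : Υ.Table) (γ : Υ.Context) (η : Finset Υ.M) (h : η ⊆ γ.1)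
    (u : Υ.Outcomes η) : ℝ :=
  ∑ s : Υ.Outcomes γ.1, if (∀ x : {x // x ∈ η}, s ⟨x.1, h x.2⟩ = u x) then B γ s else 0

/-- The no-disturbance set. -/
def ND (Υ : Scenario) : Set Υ.Table :=
  {B | IsBehavior B ∧ ∀ γ γ' : Υ.Context, ∀ u : Υ.Outcomes (γ.1 ∩ γ'.1),
    marginal B γ (γ.1 ∩ γ'.1) Finset.inter_subset_left u =
      marginal B γ' (γ.1 ∩ γ'.1) Finset.inter_subset_right u}

/-- The (Kochen-Specker) noncontextual set: behaviors with a global section. -/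
def NC (Υ : Scenario) : Set Υ.Table :=
  {B | ∃ P : (∀ x, Υ.O x) → ℝ, (∀ t, 0 ≤ P t) ∧ ∑ t, P t = 1 ∧
    ∀ (γ : Υ.Context) (s : Υ.Outcomes γ.1),
      B γ s = ∑ t : (∀ x, Υ.O x), if (∀ x : {x // x ∈ γ.1}, t x = s x) then P t else 0}

/-! ### Noncontextual wirings -/

/-- The data of an adaptive wiring that turns boxes in `Υ` into boxes in `Υ'`, whose
measurements and contexts are those of the pre-processing box. -/
structure WiringData (Υ Υ' : Scenario) where
  /-- outcome sets of the pre-processing scenario -/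
  R : Υ'.M → Type
  [fintypeR : ∀ x, Fintype (R x)]
  [decEqR : ∀ x, DecidableEq (R x)]
  [nonemptyR : ∀ x, Nonempty (R x)]
  /-- the pre-processing box `p_β(r)` -/
  pre : (Υ'.withOutcomes R).Table
  /-- the context `γ = f(r)` that is measured on the given box -/
  f : ∀ β : Υ'.Context, (∀ x : {x // x ∈ β.1}, R x) → Υ.Context
  /-- the measurement in `f(r)` whose outcome `s_i` is passed on by the `i`-th component `β_i` -/
  component : ∀ (β : Υ'.Context) (r : ∀ x : {x // x ∈ β.1}, R x),
    {x // x ∈ β.1} → {y // y ∈ (f β r).1}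
  /-- the post-processing scenarios, which may depend on `(r, β)` -/
  Pos : ∀ β : Υ'.Context, (∀ x : {x // x ∈ β.1}, R x) → Scenario
  /-- the post-processing boxes -/
  pos : ∀ (β : Υ'.Context) (r : ∀ x : {x // x ∈ β.1}, R x), (Pos β r).Table
  /-- the functions `g_i(s_i | r, β)` -/
  g : ∀ (β : Υ'.Context) (r : ∀ x : {x // x ∈ β.1}, R x) (x : {x // x ∈ β.1}),
    Υ.O (component β r x).1 → (Pos β r).M
  /-- `g(s | r, β) = ⋃ g_i(s_i | r, β)` is a maximal context -/
  g_context : ∀ (β : Υ'.Context) (r : ∀ x : {x // x ∈ β.1}, R x) (s : Υ.Outcomes (f β r).1),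
    Finset.univ.image (fun x => g β r x (s (component β r x))) ∈ (Pos β r).contexts
  /-- reads the outcome of the post-processing measurement `g_i(s_i | r, β)` as an outcome of the
  measurement `β_i` of the final scenario -/
  out : ∀ (β : Υ'.Context) (r : ∀ x : {x // x ∈ β.1}, R x) (x : {x // x ∈ β.1})
    (o : Υ.O (component β r x).1), (Pos β r).O (g β r x o) → Υ'.O x.1

attribute [instance] WiringData.fintypeR WiringData.decEqR WiringData.nonemptyR

namespace WiringData

variable {Υ Υ' : Scenario} (W : WiringData Υ Υ')

/-- Joint outcomes `r` of the pre-processing box in the context `β`. -/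
abbrev PreOutcomes (β : Υ'.Context) : Type := ∀ x : {x // x ∈ β.1}, W.R x

/-- The context `δ = g(s | r, β)` of the post-processing scenario. -/
def δ (β : Υ'.Context) (r : W.PreOutcomes β) (s : Υ.Outcomes (W.f β r).1) :
    (W.Pos β r).Context :=
  ⟨Finset.univ.image (fun x => W.g β r x (s (W.component β r x))), W.g_context β r s⟩

/-- The post-processing probability `p_{δ = g(s|r,β)}(t)`. -/
def post (β : Υ'.Context) (r : W.PreOutcomes β) (s : Υ.Outcomes (W.f β r).1)
    (t : Υ'.Outcomes β.1) : ℝ :=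
  ∑ q : (W.Pos β r).Outcomes (W.δ β r s).1,
    if (∀ x, W.out β r x (s (W.component β r x))
        (q ⟨_, Finset.mem_image_of_mem _ (Finset.mem_univ x)⟩) = t x)
    then W.pos β r (W.δ β r s) q else 0

/-- The box `W(B)`: `p_β(t) = ∑_{r,s} p_β(r) p_{f(r)}(s) p_{g(s|r,β)}(t)`. -/
def apply (B : Υ.Table) : Υ'.Table := fun β t =>
  ∑ r : W.PreOutcomes β, W.pre β r *
    ∑ s : Υ.Outcomes (W.f β r).1, B (W.f β r) s * W.post β r s t

/-- The wiring is noncontextual: pre- and post-processing boxes are noncontextual, and the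
adaptivity respects this. The latter means that every component `β_i` of the input context acts on
what it holds: the measurement it wires to is fixed by `(β_i, r_i)`, and the post-processing box,
as a box with inputs `(β_i, r_i, s_i)` and outputs `t_i`, is still factorizable, with a hidden
variable `φ` distributed independently of `β`, `r` and `s`. -/
structure IsNoncontextual : Prop where
  pre_nc : W.pre ∈ NC (Υ'.withOutcomes W.R)
  pos_nc : ∀ β r, W.pos β r ∈ NC (W.Pos β r)
  component_local : ∃ m : ∀ x, W.R x → Υ.M, ∀ (β : Υ'.Context) (r : W.PreOutcomes β),
    W.pre β r ≠ 0 → ∀ x, (W.component β r x).1 = m x.1 (r x)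
  factorizable : ∃ (Φ : Type) (_ : Fintype Φ) (q : Φ → ℝ)
    (p : Φ → ∀ x, W.R x → (Σ y, Υ.O y) → Υ'.O x → ℝ),
    (∀ φ, 0 ≤ q φ) ∧ ∑ φ, q φ = 1 ∧
    (∀ φ x ρ o, (∀ t, 0 ≤ p φ x ρ o t) ∧ ∑ t, p φ x ρ o t = 1) ∧
    ∀ (β : Υ'.Context) (r : W.PreOutcomes β) (s : Υ.Outcomes (W.f β r).1)
      (t : Υ'.Outcomes β.1),
      W.post β r s t =
        ∑ φ, q φ * ∏ x : {x // x ∈ β.1},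
          p φ x.1 (r x) ⟨(W.component β r x).1, s (W.component β r x)⟩ (t x)

end WiringData

/-! ### The order induced by noncontextual wirings -/

/-- The objects of the resource theory: nondisturbing behaviors in arbitrary scenarios. -/
abbrev Obj : Type 1 := Σ Υ : Scenario, {B : Υ.Table // B ∈ ND Υ}

/-- `X → Y`: some noncontextual wiring transforms `X` into `Y`. -/
def Converts (X Y : Obj) : Prop :=
  ∃ W : WiringData X.1 Y.1, W.IsNoncontextual ∧ W.apply X.2.1 = Y.2.1

/-- Every pair of distinct elements is strictly ordered. -/
def IsNCWChain (S : Set Obj) : Prop :=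
  S.Pairwise fun X Y => (Converts X Y ∧ ¬ Converts Y X) ∨ (Converts Y X ∧ ¬ Converts X Y)

/-- Every pair of distinct elements is incomparable. -/
def IsNCWAntichain (S : Set Obj) : Prop :=
  S.Pairwise fun X Y => ¬ Converts X Y ∧ ¬ Converts Y X

/-- The height: the supremum of the cardinalities of chains. -/
def height : Cardinal.{1} := ⨆ S : {S : Set Obj // IsNCWChain S}, #S.1

/-- The width: the supremum of the cardinalities of antichains. -/
def width : Cardinal.{1} := ⨆ S : {S : Set Obj // IsNCWAntichain S}, #S.1

/-- The objects given by the nondisturbing tables in a set `S`. -/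
def objects (Υ : Scenario) (S : Set Υ.Table) : Set Obj :=
  {X | ∃ B : {B : Υ.Table // B ∈ ND Υ}, B.1 ∈ S ∧ X = ⟨Υ, B⟩}

/-! ### The `n`-cycle scenarios -/

theorem card_edge (n : ℕ) (i j : ZMod n) :
    ({i, i + 1} : Finset (ZMod n)).card = ({j, j + 1} : Finset (ZMod n)).card := by
  by_cases h : (1 : ZMod n) = 0
  · simp [h]
  · rw [Finset.card_pair (by simpa using h), Finset.card_pair (by simpa using h)]

/-- The `n`-cycle scenario: dichotomic measurements `x_i`, contexts `{x_i, x_{i+1}}`. -/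
abbrev cycle (n : ℕ) [NeZero n] : Scenario where
  M := ZMod n
  contexts := Finset.univ.image fun i => {i, i + 1}
  maximal := by
    intro γ hγ γ' hγ' h
    simp only [Finset.mem_image, Finset.mem_univ, true_and] at hγ hγ'
    obtain ⟨i, rfl⟩ := hγ
    obtain ⟨j, rfl⟩ := hγ'
    exact Finset.eq_of_subset_of_card_le h (card_edge n j i).le
  O := fun _ => Fin 2

/-- The context `{x_i, x_{i+1}}`. -/
def edge (n : ℕ) [NeZero n] (i : ZMod n) : (cycle n).Context :=
  ⟨({i, i + 1} : Finset (ZMod n)), Finset.mem_image_of_mem _ (Finset.mem_univ i)⟩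

/-- The outcome `s_i ∈ {0, 1}` of a measurement in a joint outcome. -/
def bit {n : ℕ} [NeZero n] {γ : Finset (cycle n).M} (s : (cycle n).Outcomes γ)
    (x : {x // x ∈ γ}) : Fin 2 := s x

/-- The two-point correlation `⟨x_i x_{i+1}⟩ = p(00) + p(11) - p(10) - p(01)`. -/
def correlator (n : ℕ) [NeZero n] (B : (cycle n).Table) (i : ZMod n) : ℝ :=
  ∑ s : (cycle n).Outcomes (edge n i).1,
    (if bit s ⟨i, Finset.mem_insert_self i {i + 1}⟩ =
        bit s ⟨i + 1, Finset.mem_insert_of_mem (Finset.mem_singleton_self (i + 1))⟩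
      then 1 else -1) * B (edge n i) s

/-- The functional `I_k` attached to a choice of signs `a`. -/
def cycleFunctional (n : ℕ) [NeZero n] (a : ZMod n → ℤˣ) (B : (cycle n).Table) : ℝ :=
  ∑ i, ((a i : ℤ) : ℝ) * correlator n B i

/-- Nondisturbing contextual vertices. -/
def NDC (n : ℕ) [NeZero n] : Set (cycle n).Table :=
  (ND (cycle n)).extremePoints ℝ \ (NC (cycle n)).extremePoints ℝ

/-- The behavior in which all joint outcomes of every context are equally likely. -/
def uniformBehavior (Υ : Scenario) : Υ.Table := fun γ _ => (Fintype.card (Υ.Outcomes γ.1) : ℝ)⁻¹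

/-- The behavior `B_k' = (n-2)/n B_k + 2/n B_∅`. -/
def basePoint (n : ℕ) [NeZero n] (Bk : (cycle n).Table) : (cycle n).Table :=
  (((n : ℝ) - 2) / n) • Bk + ((2 : ℝ) / n) • uniformBehavior (cycle n)

/-- The behavior `B_ε = ε B_k + (1-ε) B_k'`. -/
def segmentPoint (n : ℕ) [NeZero n] (Bk : (cycle n).Table) (ε : ℝ) : (cycle n).Table :=
  ε • Bk + (1 - ε) • basePoint n Bk

/-- The segment `P_k`. -/
def segmentP (n : ℕ) [NeZero n] (Bk : (cycle n).Table) : Set (cycle n).Table :=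
  {B | ∃ ε ∈ Set.Icc (0 : ℝ) 1, B = segmentPoint n Bk ε}

/-- The behavior `B(α, ε) = α B̃ + (1-α) B_ε`. -/
def twoParam (n : ℕ) [NeZero n] (Bk Bt : (cycle n).Table) (α ε : ℝ) : (cycle n).Table :=
  α • Bt + (1 - α) • segmentPoint n Bk ε

/-- The segment `{B(x, x) : 1/2 ≤ x < 1}`. -/
def diagonal (n : ℕ) [NeZero n] (Bk Bt : (cycle n).Table) : Set (cycle n).Table :=
  {B | ∃ x ∈ Set.Ico (1 / 2 : ℝ) 1, B = twoParam n Bk Bt x x}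

end KSContextuality

end

noncomputable section

namespace KSContextuality

/-! A noncontextual wiring is a convex mixture of deterministic local maps: once the hidden
variables of the pre-processing box and of the factorized response are fixed, each target
measurement reads one source measurement and relabels its outcome
(`WiringData.IsNoncontextual.exists_localMap_decomposition`). Hence a wiring acts linearly, and
local maps can be studied one at a time.

The functional `I_k` is at most `n - 2` on `NC`, and on `ND` it reaches its maximum `n` only at
`prBox`, which is `B_k`. By `LocalMap.push_dichotomy`, a local map of the cycle to itself either
brings `I_k(B_k)` down to at most `n - 2` or fixes both `B_k` and `B_k'`. This is a parity argument:
to stay above `n - 2`, all relabellings must be bijective and the closed walk of simulated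
measurements must have sign product `-1`; a walk that rests somewhere misses an edge and has product
`1`. With total weight `w` on the fixing maps, the wiring `L` satisfies `I_k(L B_k) ≤ n - 2 + 2w`,
and entrywise `L B_k ≥ w B_k` and `L B_k' ≥ w B_k'` (`WiringData.IsNoncontextual.exists_weight`).

Chain: `I_k(B_ε) = n - 2 + 2ε` cannot be raised, since `B_k'` is noncontextual, while mixing with
`B_k'` lowers `ε` freely (`converts_mix`).

Antichain: `I_k(B(x,x)) = n - 2 + 2x(1-x)` decreases strictly in `x`, so `x` cannot be lowered. If
`x` were raised to `y`, the functional would give `w x(1-x) ≥ y(1-y)`; an entry where the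
deterministic `B̃` vanishes would then give `w (1-x)² ≤ (1-y)²`, and the two together force `y ≤ x`
(`not_converts_twoParam`). -/

/-! ### Deterministic behaviors -/

/-- The table with all weight on the restrictions of one global assignment. -/
def det {Υ : Scenario} (T : ∀ x, Υ.O x) : Υ.Table := fun γ s =>
  if (∀ x : {x // x ∈ γ.1}, T x = s x) then 1 else 0

/-- The restriction of a global assignment to a set of measurements. -/
def restr {Υ : Scenario} (T : ∀ x, Υ.O x) (γ : Finset Υ.M) : Υ.Outcomes γ := fun x => T x

theorem det_eq_ite {Υ : Scenario} (T : ∀ x, Υ.O x) (γ : Υ.Context) (s : Υ.Outcomes γ.1) :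
    det T γ s = if s = restr T γ.1 then 1 else 0 := by
  unfold det restr
  congr 1
  simp only [funext_iff, eq_iff_iff]
  exact forall_congr' fun x => eq_comm

theorem sum_det_mul {Υ : Scenario} (T : ∀ x, Υ.O x) (γ : Υ.Context) (F : Υ.Outcomes γ.1 → ℝ) :
    ∑ s, det T γ s * F s = F (restr T γ.1) := by
  simp [det_eq_ite]

theorem marginal_eq_sum_mul {Υ : Scenario} (B : Υ.Table) (γ : Υ.Context) (η : Finset Υ.M)
    (h : η ⊆ γ.1) (u : Υ.Outcomes η) :
    marginal B γ η h u =
      ∑ s, B γ s * if (∀ x : {x // x ∈ η}, s ⟨x.1, h x.2⟩ = u x) then 1 else 0 := by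
  simp [marginal]

theorem det_mem_ND {Υ : Scenario} (T : ∀ x, Υ.O x) : det T ∈ ND Υ := by
  refine ⟨fun γ => ⟨fun s => ?_, ?_⟩, fun γ γ' u => ?_⟩
  · unfold det; split_ifs <;> norm_num
  · simpa using sum_det_mul T γ fun _ => 1
  · simp only [marginal_eq_sum_mul, sum_det_mul]
    rfl

theorem det_mem_NC {Υ : Scenario} (T : ∀ x, Υ.O x) : det T ∈ NC Υ := by
  classical
  refine ⟨fun t => if t = T then 1 else 0, fun t => by positivity, by simp, fun γ s => ?_⟩
  rw [Finset.sum_eq_single T]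
  · simp [det]
  · intro b _ hb; simp [hb]
  · simp

theorem mem_NC_iff {Υ : Scenario} (B : Υ.Table) :
    B ∈ NC Υ ↔ ∃ P : (∀ x, Υ.O x) → ℝ, (∀ t, 0 ≤ P t) ∧ ∑ t, P t = 1 ∧ B = ∑ t, P t • det t := by
  refine exists_congr fun P => and_congr_right fun _ => and_congr_right fun _ => ?_
  simp only [funext_iff]
  refine forall_congr' fun γ => forall_congr' fun s => ?_
  simp [Finset.sum_apply, det]

theorem convex_NC (Υ : Scenario) : Convex ℝ (NC Υ) := by
  intro B hB C hC p q hp hq hpq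
  rw [mem_NC_iff] at *
  obtain ⟨P, hP, hP1, rfl⟩ := hB
  obtain ⟨Q, hQ, hQ1, rfl⟩ := hC
  refine ⟨fun t => p * P t + q * Q t, fun t => ?_, ?_, ?_⟩
  · have := hP t; have := hQ t; positivity
  · rw [Finset.sum_add_distrib, ← Finset.mul_sum, ← Finset.mul_sum, hP1, hQ1]; linarith
  · simp [add_smul, mul_smul, Finset.sum_add_distrib, Finset.smul_sum]

theorem convex_ND (Υ : Scenario) : Convex ℝ (ND Υ) := by
  intro B hB C hC p q hp hq hpq
  have key : ∀ (γ : Υ.Context) (F : Υ.Outcomes γ.1 → ℝ),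
      ∑ s, (p • B + q • C) γ s * F s = p * ∑ s, B γ s * F s + q * ∑ s, C γ s * F s := by
    intro γ F
    simp only [Finset.mul_sum, ← Finset.sum_add_distrib]
    refine Finset.sum_congr rfl fun s _ => ?_
    simp; ring
  refine ⟨fun γ => ⟨fun s => ?_, ?_⟩, fun γ γ' u => ?_⟩
  · have := (hB.1 γ).1 s; have := (hC.1 γ).1 s
    simp only [Pi.add_apply, Pi.smul_apply, smul_eq_mul]; positivity
  · have := key γ fun _ => 1
    simp only [mul_one] at this
    rw [this, (hB.1 γ).2, (hC.1 γ).2]; linarith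
  · have h1 := hB.2 γ γ' u
    have h2 := hC.2 γ γ' u
    simp only [marginal_eq_sum_mul] at *
    rw [key, key, h1, h2]

/-- Linear inequalities on `NC` thereby need checking only on deterministic tables, and every vertex
of `NC` is one of them. -/
theorem convexHull_range_det (Υ : Scenario) :
    convexHull ℝ (Set.range (det : (∀ x, Υ.O x) → Υ.Table)) = NC Υ := by
  refine (convexHull_min ?_ (convex_NC Υ)).antisymm ?_
  · rintro _ ⟨T, rfl⟩; exact det_mem_NC T
  · intro B hB
    obtain ⟨P, hP, hP1, rfl⟩ := (mem_NC_iff B).1 hB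
    exact (convex_convexHull ℝ _).sum_mem (fun t _ => hP t) hP1
      fun t _ => subset_convexHull ℝ _ ⟨t, rfl⟩

theorem NC_subset_ND (Υ : Scenario) : NC Υ ⊆ ND Υ := by
  rw [← convexHull_range_det]
  refine convexHull_min ?_ (convex_ND Υ)
  rintro _ ⟨T, rfl⟩; exact det_mem_ND T

theorem exists_det_of_mem_extremePoints_NC {Υ : Scenario} {B : Υ.Table}
    (hB : B ∈ (NC Υ).extremePoints ℝ) : ∃ T, det T = B := by
  rw [← convexHull_range_det] at hB
  obtain ⟨T, hT⟩ := extremePoints_convexHull_subset hB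
  exact ⟨T, hT⟩

theorem det_mem_extremePoints_NC {Υ : Scenario} (T : ∀ x, Υ.O x) :
    det T ∈ (NC Υ).extremePoints ℝ := by
  refine mem_extremePoints_iff_left.2 ⟨det_mem_NC T, fun B hB C hC => ?_⟩
  rintro ⟨p, q, hp, hq, hpq, h⟩
  have hB := (NC_subset_ND Υ hB).1
  have hC := (NC_subset_ND Υ hC).1
  funext γ s
  -- Where the point mass vanishes, a positive mixture of nonnegative entries vanishes, so `B` does
  -- too; normalization fixes the remaining entry.
  have h0 : ∀ s, s ≠ restr T γ.1 → B γ s = 0 := by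
    intro s hs
    have h1 := congrFun (congrFun h γ) s
    rw [det_eq_ite, if_neg hs] at h1
    simp only [Pi.add_apply, Pi.smul_apply, smul_eq_mul] at h1
    have := (hB γ).1 s
    have := mul_nonneg hq.le ((hC γ).1 s)
    nlinarith
  rw [det_eq_ite]
  split_ifs with hs
  · rw [← (hB γ).2, Finset.sum_eq_single s (fun b _ hb => h0 b (hs ▸ hb)) (by simp)]
  · exact h0 s hs

/-! ### Deterministic local maps -/

/-- A deterministic local wiring: each measurement `x` of the target is simulated by the
measurement `μ x` of the source, with the outcome relabelled by `h x`. -/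
structure LocalMap (Υ Υ' : Scenario) where
  F : Υ'.Context → Υ.Context
  μ : Υ'.M → Υ.M
  mem : ∀ (β : Υ'.Context) (x : {x // x ∈ β.1}), μ x ∈ (F β).1
  h : ∀ x, Υ.O (μ x) → Υ'.O x

namespace LocalMap

variable {Υ Υ' : Scenario} (D : LocalMap Υ Υ')

/-- The joint outcome of the target determined by a joint outcome of the source. -/
def mapOut (β : Υ'.Context) (s : Υ.Outcomes (D.F β).1) : Υ'.Outcomes β.1 :=
  fun x => D.h x (s ⟨D.μ x, D.mem β x⟩)

/-- The action of a deterministic local wiring on tables. -/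
def push : Υ.Table →ₗ[ℝ] Υ'.Table where
  toFun B β t := ∑ s, B (D.F β) s * if D.mapOut β s = t then 1 else 0
  map_add' B C := by
    funext β t
    simp only [Pi.add_apply, add_mul, Finset.sum_add_distrib]
  map_smul' c B := by
    funext β t
    simp only [Pi.smul_apply, smul_eq_mul, mul_assoc, Finset.mul_sum, RingHom.id_apply]

theorem push_apply (B : Υ.Table) (β : Υ'.Context) (t : Υ'.Outcomes β.1) :
    D.push B β t = ∑ s, B (D.F β) s * if D.mapOut β s = t then 1 else 0 := rfl

theorem push_nonneg {B : Υ.Table} (hB : ∀ γ s, 0 ≤ B γ s) (β t) : 0 ≤ D.push B β t := by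
  rw [push_apply]
  exact Finset.sum_nonneg fun s _ => mul_nonneg (hB _ _) (by positivity)

theorem sum_push_mul (B : Υ.Table) (β : Υ'.Context) (G : Υ'.Outcomes β.1 → ℝ) :
    ∑ t, D.push B β t * G t = ∑ s, B (D.F β) s * G (D.mapOut β s) := by
  simp only [push_apply, Finset.sum_mul]
  rw [Finset.sum_comm]
  simp

theorem push_det (T : ∀ x, Υ.O x) : D.push (det T) = det fun x => D.h x (T (D.μ x)) := by
  funext β t
  rw [push_apply, sum_det_mul, det_eq_ite]
  congr 1
  exact propext eq_comm

end LocalMap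

/-! ### Noncontextual wirings are mixtures of deterministic local maps -/

/-- A stochastic kernel is a mixture of functions: draw `h a` independently from `k a` for every
input; the value at `o` then has law `k o`. -/
theorem sum_prod_kernel_mul_ite {A C : Type*} [Fintype A] [DecidableEq A] [Fintype C]
    [DecidableEq C] (k : A → C → ℝ) (hk : ∀ a, ∑ c, k a c = 1) (o : A) (t : C) :
    ∑ h : A → C, (∏ a, k a (h a)) * (if h o = t then 1 else 0) = k o t := by
  have : ∀ h : A → C, (∏ a, k a (h a)) * (if h o = t then 1 else 0) =
      ∏ a, k a (h a) * (if a = o then (if h a = t then 1 else 0) else 1) := by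
    intro h
    rw [Finset.prod_mul_distrib]
    congr 1
    rw [Finset.prod_ite_eq' Finset.univ o fun a => if h a = t then (1 : ℝ) else 0]
    simp
  simp only [this]
  have h2 := Finset.prod_univ_sum (fun _ : A => (Finset.univ : Finset C))
    (fun a c => k a c * (if a = o then (if c = t then 1 else 0) else 1))
  rw [Fintype.piFinset_univ] at h2
  rw [← h2, Finset.prod_eq_single o]
  · simp
  · intro b _ hb; simp [hb, hk]
  · simp

theorem sum_prod_kernel {A C : Type*} [Fintype A] [DecidableEq A] [Fintype C]
    (k : A → C → ℝ) (hk : ∀ a, ∑ c, k a c = 1) :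
    ∑ h : A → C, (∏ a, k a (h a)) = 1 := by
  have h2 := Finset.prod_univ_sum (fun _ : A => (Finset.univ : Finset C)) k
  rw [Fintype.piFinset_univ] at h2
  rw [← h2]; simp [hk]

theorem sum_prod_prod_kernel {X : Type*} [Fintype X] [DecidableEq X] {A C : X → Type*}
    [∀ x, Fintype (A x)] [∀ x, DecidableEq (A x)] [∀ x, Fintype (C x)]
    (k : ∀ x, A x → C x → ℝ) (hk : ∀ x a, ∑ c, k x a c = 1) :
    ∑ h : ∀ x, A x → C x, ∏ x, ∏ a, k x a (h x a) = 1 := by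
  have h2 := Finset.prod_univ_sum (fun x => (Finset.univ : Finset (A x → C x)))
    (fun x h => ∏ a, k x a (h a))
  rw [Fintype.piFinset_univ] at h2
  rw [← h2]
  exact Finset.prod_eq_one fun x _ => sum_prod_kernel (k x) (hk x)

/-- The response functions are drawn independently over all `x`, with a law that does not mention
`β`; the factors outside `β` sum to one. -/
theorem sum_prod_prod_kernel_mul_ite {X : Type*} [Fintype X] [DecidableEq X] {A C : X → Type*}
    [∀ x, Fintype (A x)] [∀ x, DecidableEq (A x)] [∀ x, Fintype (C x)] [∀ x, DecidableEq (C x)]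
    (k : ∀ x, A x → C x → ℝ) (hk : ∀ x a, ∑ c, k x a c = 1) (β : Finset X)
    (o : ∀ x : {x // x ∈ β}, A x) (t : ∀ x : {x // x ∈ β}, C x) :
    ∑ h : ∀ x, A x → C x, (∏ x, ∏ a, k x a (h x a)) *
      (if (fun x : {x // x ∈ β} => h x (o x)) = t then 1 else 0) =
      ∏ x : {x // x ∈ β}, k x (o x) (t x) := by
  have : ∀ h : ∀ x, A x → C x, (∏ x, ∏ a, k x a (h x a)) *
      (if (fun x : {x // x ∈ β} => h x (o x)) = t then (1 : ℝ) else 0) =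
      ∏ x, (∏ a, k x a (h x a)) *
        (if hx : x ∈ β then (if h x (o ⟨x, hx⟩) = t ⟨x, hx⟩ then 1 else 0) else 1) := by
    intro h
    rw [Finset.prod_mul_distrib]
    congr 1
    by_cases H : (fun x : {x // x ∈ β} => h x (o x)) = t
    · rw [if_pos H, eq_comm]
      refine Finset.prod_eq_one fun x _ => ?_
      split_ifs with h1 h2
      · rfl
      · exact absurd (congrFun H ⟨x, h1⟩) h2
      · rfl
    · rw [if_neg H, eq_comm]
      obtain ⟨x, hx⟩ := Function.ne_iff.1 H
      exact Finset.prod_eq_zero (Finset.mem_univ x.1) (by simpa using hx)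
  simp only [this]
  have h2 := Finset.prod_univ_sum (fun x => (Finset.univ : Finset (A x → C x)))
    (fun x h => (∏ a, k x a (h a)) *
        (if hx : x ∈ β then (if h (o ⟨x, hx⟩) = t ⟨x, hx⟩ then 1 else 0) else 1))
  rw [Fintype.piFinset_univ] at h2
  rw [← h2]
  have h3 : ∀ x, ∑ h : A x → C x, (∏ a, k x a (h a)) *
        (if hx : x ∈ β then (if h (o ⟨x, hx⟩) = t ⟨x, hx⟩ then (1 : ℝ) else 0) else 1) =
      if hx : x ∈ β then k x (o ⟨x, hx⟩) (t ⟨x, hx⟩) else 1 := by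
    intro x
    split_ifs with hx
    · exact sum_prod_kernel_mul_ite (k x) (hk x) _ _
    · simpa using sum_prod_kernel (k x) (hk x)
  rw [Finset.prod_congr rfl fun x _ => h3 x, Finset.prod_dite]
  simp only [Finset.prod_const_one, mul_one]
  refine Fintype.prod_equiv (Equiv.subtypeEquivRight (by simp)) _ _ ?_
  intro x; rfl

theorem sum_subtype_ne_zero_mul {α : Type*} [Fintype α] (P F : α → ℝ)
    [DecidablePred fun a => P a ≠ 0] :
    ∑ a : {a // P a ≠ 0}, P a.1 * F a.1 = ∑ a, P a * F a := by
  have h : ∀ a ∈ Finset.univ, P a * F a ≠ 0 → P a ≠ 0 := fun a _ h => left_ne_zero_of_mul h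
  rw [← Finset.sum_filter_of_ne h]
  exact (Finset.sum_subtype (p := fun a => P a ≠ 0) _ (by simp) fun a => P a * F a).symm

theorem WiringData.IsNoncontextual.exists_localMap_decomposition {Υ Υ' : Scenario}
    {W : WiringData Υ Υ'} (hW : W.IsNoncontextual) :
    ∃ (ι : Type) (_ : Fintype ι) (w : ι → ℝ) (D : ι → LocalMap Υ Υ'),
      (∀ i, 0 ≤ w i) ∧ ∑ i, w i = 1 ∧ ∀ B, W.apply B = ∑ i, w i • (D i).push B := by
  classical
  obtain ⟨P, hP, hP1, hpre⟩ := hW.pre_nc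
  obtain ⟨m, hm⟩ := hW.component_local
  obtain ⟨Φ, _, q, p, hq, hq1, hp, hpost⟩ := hW.factorizable
  -- Locality of the component is assumed only where `W.pre` is nonzero. A global assignment of
  -- nonzero weight has nonzero restrictions to all contexts, so the mixture runs over those alone.
  have hcomp : ∀ (ρ : {ρ // P ρ ≠ 0}) (β : Υ'.Context) (x : {x // x ∈ β.1}),
      (W.component β (fun x => ρ.1 x) x).1 = m x (ρ.1 x) := by
    intro ρ β x
    refine hm β (fun x => ρ.1 x) ?_ x
    have h1 : P ρ.1 ≤ W.pre β fun x => ρ.1 x := by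
      rw [hpre β]
      have := Finset.single_le_sum (f := fun t : (∀ x, W.R x) =>
        if (∀ x : {x // x ∈ β.1}, t x = ρ.1 x) then P t else 0)
        (fun t _ => by dsimp only; split_ifs <;> simp [hP]) (Finset.mem_univ ρ.1)
      simpa using this
    exact (lt_of_lt_of_le (lt_of_le_of_ne (hP ρ.1) ρ.2.symm) h1).ne'
  -- The index records a pre-processing assignment, the hidden variable of the response, and
  -- response functions whose domains depend on that assignment.
  let D : (Σ ρ : {ρ // P ρ ≠ 0}, Φ × (∀ x, Υ.O (m x (ρ.1 x)) → Υ'.O x)) → LocalMap Υ Υ' :=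
    fun j =>
    { F := fun β => W.f β fun x => j.1.1 x
      μ := fun x => m x (j.1.1 x)
      mem := fun β x => by rw [← hcomp j.1 β x]; exact (W.component β _ x).2
      h := j.2.2 }
  refine ⟨_, inferInstance, fun j => P j.1.1 * (q j.2.1 *
    ∏ x, ∏ o, p j.2.1 x (j.1.1 x) ⟨m x (j.1.1 x), o⟩ (j.2.2 x o)), D, ?_, ?_, ?_⟩
  · intro j
    exact mul_nonneg (hP _) (mul_nonneg (hq _) (Finset.prod_nonneg fun x _ =>
      Finset.prod_nonneg fun o _ => (hp _ _ _ _).1 _))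
  · rw [Fintype.sum_sigma]
    have : ∀ ρ : {ρ // P ρ ≠ 0}, ∑ y : Φ × (∀ x, Υ.O (m x (ρ.1 x)) → Υ'.O x), P ρ.1 * (q y.1 *
        ∏ x, ∏ o, p y.1 x (ρ.1 x) ⟨m x (ρ.1 x), o⟩ (y.2 x o)) = P ρ.1 := by
      intro ρ
      rw [Fintype.sum_prod_type]
      simp only [← Finset.mul_sum]
      have h1 : ∀ φ, ∑ h : (∀ x, Υ.O (m x (ρ.1 x)) → Υ'.O x),
          ∏ x, ∏ o, p φ x (ρ.1 x) ⟨m x (ρ.1 x), o⟩ (h x o) = 1 := fun φ =>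
        sum_prod_prod_kernel (fun x o c => p φ x (ρ.1 x) ⟨m x (ρ.1 x), o⟩ c)
          fun x a => (hp φ x _ _).2
      simp [h1, hq1]
    rw [Finset.sum_congr rfl fun ρ _ => this ρ, ← hP1]
    simpa using sum_subtype_ne_zero_mul P fun _ => 1
  · intro B
    funext β t
    let K : ∀ r : W.PreOutcomes β, ℝ := fun r =>
      ∑ s : Υ.Outcomes (W.f β r).1, B (W.f β r) s * W.post β r s t
    have h1 : W.apply B β t = ∑ ρ, P ρ * K (fun x => ρ x) := by
      have h2 : W.apply B β t = ∑ r, W.pre β r * K r := rfl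
      rw [h2]
      have h3 : ∀ r, W.pre β r * K r =
          ∑ ρ, if (fun x : {x // x ∈ β.1} => ρ x) = r then P ρ * K r else 0 := by
        intro r
        rw [hpre β r, Finset.sum_mul]
        refine Finset.sum_congr rfl fun ρ _ => ?_
        rw [ite_mul, zero_mul]
        congr 1
        exact propext funext_iff.symm
      simp only [h3]
      rw [Finset.sum_comm]
      simp
    rw [h1, ← sum_subtype_ne_zero_mul P fun ρ => K fun x => ρ x, Finset.sum_apply, Finset.sum_apply, Fintype.sum_sigma]
    refine Finset.sum_congr rfl fun ρ _ => ?_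
    simp only [Pi.smul_apply, smul_eq_mul, mul_assoc, ← Finset.mul_sum]
    congr 1
    rw [Fintype.sum_prod_type]
    simp only [LocalMap.push_apply, ← Finset.mul_sum]
    have h5 : ∀ s : Υ.Outcomes (W.f β fun x => ρ.1 x).1, W.post β (fun x => ρ.1 x) s t =
        ∑ φ, q φ * ∑ h : (∀ x, Υ.O (m x (ρ.1 x)) → Υ'.O x),
          (∏ x, ∏ o, p φ x (ρ.1 x) ⟨m x (ρ.1 x), o⟩ (h x o)) *
            if (D ⟨ρ, φ, h⟩).mapOut β s = t then 1 else 0 := by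
      intro s
      rw [hpost]
      refine Finset.sum_congr rfl fun φ _ => ?_
      congr 1
      have hmem : ∀ x : {x // x ∈ β.1}, m x (ρ.1 x) ∈ (W.f β fun x => ρ.1 x).1 := fun x => by
        rw [← hcomp ρ β x]; exact (W.component β _ x).2
      have h6 := sum_prod_prod_kernel_mul_ite (fun x o c => p φ x (ρ.1 x) ⟨m x (ρ.1 x), o⟩ c)
        (fun x a => (hp φ x _ _).2) β.1 (fun x => s ⟨m x (ρ.1 x), hmem x⟩) t
      refine Eq.trans (Finset.prod_congr rfl fun x _ => ?_) h6.symm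
      have h7 : W.component β (fun x => ρ.1 x) x = ⟨m x (ρ.1 x), hmem x⟩ :=
        Subtype.ext (hcomp ρ β x)
      rw [h7]
    simp only [K, h5, Finset.mul_sum]
    rw [Finset.sum_comm]
    refine Finset.sum_congr rfl fun φ _ => ?_
    rw [Finset.sum_comm]
    refine Finset.sum_congr rfl fun h _ => Finset.sum_congr rfl fun s _ => ?_
    have hB : B ((D ⟨ρ, φ, h⟩).F β) s = B (W.f β fun x => ρ.1 x) s := rfl
    rw [hB]
    ring

/-! ### Signs -/

/-- The sign of an outcome. -/
def sg (u : Fin 2) : ℤˣ := if u = 0 then 1 else -1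

/-- The outcome with a given sign. -/
def bitOf (c : ℤˣ) : Fin 2 := if c = 1 then 0 else 1

/-- The outcome `u`, flipped when `c = -1`. -/
def tw (c : ℤˣ) (u : Fin 2) : Fin 2 := if c = 1 then u else 1 - u

/-- A sign as a real number. -/
def sr (c : ℤˣ) : ℝ := ((c : ℤ) : ℝ)

@[simp] theorem sr_one : sr 1 = 1 := by simp [sr]
@[simp] theorem sr_neg_one : sr (-1) = -1 := by simp [sr]
theorem sr_mul (c d : ℤˣ) : sr (c * d) = sr c * sr d := by simp [sr]
theorem sg_bitOf : ∀ c, sg (bitOf c) = c := by decide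
theorem sr_le_one (c : ℤˣ) : sr c ≤ 1 := by
  rcases Int.units_eq_one_or c with rfl | rfl <;> norm_num

/-! ### Signs around a cycle -/

theorem natCast_ne_zero_of_lt {n k : ℕ} (hk : 0 < k) (h : k < n) : (k : ZMod n) ≠ 0 := by
  rw [Ne, ZMod.natCast_eq_zero_iff]
  exact Nat.not_dvd_of_pos_of_lt hk h

theorem succ_ne {n : ℕ} (hn : 3 ≤ n) (i : ZMod n) : i + 1 ≠ i := by
  have := natCast_ne_zero_of_lt (n := n) (k := 1) (by omega) (by omega)
  simpa using this

theorem succ_succ_ne {n : ℕ} (hn : 3 ≤ n) (i : ZMod n) : i + 1 + 1 ≠ i := by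
  have := natCast_ne_zero_of_lt (n := n) (k := 2) (by omega) (by omega)
  intro h
  apply this
  have h2 : i + 1 + 1 - i = 2 := by ring
  rw [h, sub_self] at h2
  exact_mod_cast h2.symm

section Cycle

variable {n : ℕ} [NeZero n]

theorem prod_mul_succ (g : ZMod n → ℤˣ) : ∏ i, g i * g (i + 1) = 1 := by
  rw [Finset.prod_mul_distrib, Fintype.prod_equiv (Equiv.addRight (1 : ZMod n))
    (fun i => g (i + 1)) g (fun _ => rfl), Int.units_mul_self]

theorem prod_signs {a : ZMod n → ℤˣ} (ha : Odd (Finset.univ.filter fun i => a i = -1).card) :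
    ∏ i, a i = -1 := by
  have h : ∀ i, a i = if a i = -1 then -1 else 1 := by
    intro i
    rcases Int.units_eq_one_or (a i) with h | h <;> rw [h] <;> decide
  rw [Finset.prod_congr rfl fun i _ => h i, Finset.prod_ite]
  simp [ha.neg_one_pow]

theorem forall_of_succ {p : ZMod n → Prop} (h : ∀ i, p i → p (i + 1)) {i : ZMod n} (hi : p i)
    (j : ZMod n) : p j := by
  have : ∀ k : ℕ, p (i + k) := by
    intro k
    induction k with
    | zero => simpa using hi
    | succ k ih => rw [Nat.cast_succ, ← add_assoc]; exact h _ ih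
  have h2 := this (j - i).val
  rwa [ZMod.natCast_zmod_val, add_sub_cancel] at h2

/-- Without the edge `j` the cycle is a path, along which signs integrate: `g x` is the product of
the signs from `j + 1` to `x`. -/
theorem exists_gauge (a : ZMod n → ℤˣ) (j : ZMod n) :
    ∃ g : ZMod n → ℤˣ, ∀ i, i ≠ j → g i * g (i + 1) = a i := by
  refine ⟨fun x => ∏ m ∈ Finset.range (x - (j + 1)).val, a (j + 1 + m), fun i hi => ?_⟩
  -- The distance from `j + 1` wraps around only on passing the cut edge, that is, for `i = j`.
  have h1 : (i + 1 - (j + 1)).val = (i - (j + 1)).val + 1 := by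
    have h2 : i + 1 - (j + 1) = (i - (j + 1)) + 1 := by ring
    rw [h2]
    have hlt := ZMod.val_lt (i - (j + 1))
    have hne : (i - (j + 1)).val + 1 ≠ n := by
      intro h
      apply hi
      have h3 : (((i - (j + 1)).val + 1 : ℕ) : ZMod n) = 0 := by rw [h, ZMod.natCast_self]
      rw [Nat.cast_add, ZMod.natCast_zmod_val, Nat.cast_one] at h3
      linear_combination h3
    have h4 : i - (j + 1) + 1 = (((i - (j + 1)).val + 1 : ℕ) : ZMod n) := by
      rw [Nat.cast_add, ZMod.natCast_zmod_val, Nat.cast_one]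
    rw [h4, ZMod.val_cast_of_lt (by omega)]
  simp only [h1, Finset.prod_range_succ]
  rw [← mul_assoc, Int.units_mul_self, one_mul, ZMod.natCast_zmod_val, add_sub_cancel]

/-- The products of neighbouring gauge signs multiply to `1` around the cycle and the `a i` to `-1`,
so the mismatch falls on the cut edge. -/
theorem gauge_at {a : ZMod n → ℤˣ} (ha : ∏ i, a i = -1) {j : ZMod n} {g : ZMod n → ℤˣ}
    (hg : ∀ i, i ≠ j → g i * g (i + 1) = a i) : g j * g (j + 1) = -a j := by
  have h1 : ∏ i, (g i * g (i + 1)) * a i = -1 := by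
    rw [Finset.prod_mul_distrib, prod_mul_succ, ha, one_mul]
  rw [Finset.prod_eq_single j (fun i _ hi => by rw [hg i hi, Int.units_mul_self]) (by simp)] at h1
  rw [eq_comm, ← mul_one (-a j), ← Int.units_mul_self (a j)]
  calc _ = (-1) * a j * (a j * a j) := by simp
    _ = _ := by rw [← h1, Int.units_mul_self, mul_one, mul_assoc, Int.units_mul_self, mul_one]

/-- Factors `-1` come in even number, so one is never alone. -/
theorem prod_neg_one_of_exists_unique {v : ZMod n → ℤˣ} (hv : ∏ i, v i = 1) {i : ZMod n}
    (hi : v i = -1) : ∃ j ≠ i, v j = -1 := by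
  by_contra! h
  rw [Finset.prod_eq_single i (fun j _ hj => (Int.units_eq_one_or _).resolve_right (h j hj))
    (by simp), hi] at hv
  exact absurd hv (by decide)

theorem sum_le_of_two_nonpos {v : ZMod n → ℝ} (hv : ∀ i, v i ≤ 1) {i j : ZMod n} (hij : i ≠ j)
    (hi : v i ≤ 0) (hj : v j ≤ 0) : ∑ i, v i ≤ n - 2 := by
  have h : ∑ k, v k ≤ ∑ k, ((1 - if k = i then 1 else 0) - if k = j then 1 else 0 : ℝ) := by
    refine Finset.sum_le_sum fun k _ => ?_
    by_cases h1 : k = i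
    · subst h1; simpa [hij] using hi
    · by_cases h2 : k = j
      · subst h2; simpa [h1] using hj
      · simpa [h1, h2] using hv k
  refine h.trans_eq ?_
  simp [Finset.sum_sub_distrib]
  ring

theorem sum_le_of_le_neg_one {v : ZMod n → ℝ} (hv : ∀ i, v i ≤ 1) {i : ZMod n}
    (hi : v i ≤ -1) : ∑ i, v i ≤ n - 2 := by
  have h : ∑ k, v k ≤ ∑ k, (1 - if k = i then 2 else 0 : ℝ) := by
    refine Finset.sum_le_sum fun k _ => ?_
    by_cases h1 : k = i
    · subst h1; norm_num; linarith
    · simpa [h1] using hv k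
  refine h.trans_eq ?_
  simp [Finset.sum_sub_distrib]

theorem exists_neg_of_prod {v : ZMod n → ℤˣ} (hv : ∏ i, v i = -1) : ∃ i, v i = -1 := by
  by_contra! h
  rw [Finset.prod_eq_one fun i _ => (Int.units_eq_one_or _).resolve_right (h i)] at hv
  exact absurd hv (by decide)

/-! ### Edges of the cycle scenario -/

theorem mem_edge {i x : ZMod n} : x ∈ (edge n i).1 ↔ x = i ∨ x = i + 1 := by
  simp [edge]

theorem left_mem (i : ZMod n) : i ∈ (edge n i).1 := mem_edge.2 (Or.inl rfl)
theorem right_mem (i : ZMod n) : i + 1 ∈ (edge n i).1 := mem_edge.2 (Or.inr rfl)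

theorem eq_of_mem_edge (hn : 3 ≤ n) {i j : ZMod n} (h : i ∈ (edge n j).1)
    (h' : i + 1 ∈ (edge n j).1) : i = j := by
  rw [mem_edge] at h h'
  rcases h with h | h
  · exact h
  · subst h
    rcases h' with h' | h'
    · exact absurd h' (succ_succ_ne hn j)
    · exact absurd h' (succ_ne hn _)

theorem exists_edge (γ : (cycle n).Context) : ∃ i, edge n i = γ := by
  obtain ⟨γ, h⟩ := γ
  obtain ⟨i, -, rfl⟩ := Finset.mem_image.1 h
  exact ⟨i, rfl⟩

/-- The joint outcome of an edge with prescribed values. -/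
def mkOut (i : ZMod n) (u v : Fin 2) : (cycle n).Outcomes (edge n i).1 :=
  fun x => if x.1 = i then u else v

theorem bit_mkOut (i : ZMod n) (u v : Fin 2) (x : {x // x ∈ (edge n i).1}) :
    bit (mkOut i u v) x = if x.1 = i then u else v := rfl

theorem ext_edge {i : ZMod n} {s t : (cycle n).Outcomes (edge n i).1}
    (h : bit s ⟨i, left_mem i⟩ = bit t ⟨i, left_mem i⟩)
    (h' : bit s ⟨i + 1, right_mem i⟩ = bit t ⟨i + 1, right_mem i⟩) : s = t := by
  funext ⟨x, hx⟩
  rcases mem_edge.1 hx with rfl | rfl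
  · exact h
  · exact h'

/-- Joint outcomes of an edge are pairs of outcomes. -/
def edgeEquiv (hn : 3 ≤ n) (i : ZMod n) : Fin 2 × Fin 2 ≃ (cycle n).Outcomes (edge n i).1 where
  toFun p := mkOut i p.1 p.2
  invFun s := (bit s ⟨i, left_mem i⟩, bit s ⟨i + 1, right_mem i⟩)
  left_inv p := by simp [bit_mkOut, succ_ne hn]
  right_inv s := ext_edge (by simp [bit_mkOut]) (by simp [bit_mkOut, succ_ne hn])

theorem sum_edge (hn : 3 ≤ n) (i : ZMod n) (F : (cycle n).Outcomes (edge n i).1 → ℝ) :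
    ∑ s, F s = F (mkOut i 0 0) + F (mkOut i 0 1) + (F (mkOut i 1 0) + F (mkOut i 1 1)) := by
  rw [← (edgeEquiv hn i).sum_comp, Fintype.sum_prod_type]
  simp [Fin.sum_univ_two, edgeEquiv]

theorem correlator_eq (B : (cycle n).Table) (i : ZMod n) :
    correlator n B i = ∑ s, B (edge n i) s *
      sr (sg (bit s ⟨i, left_mem i⟩) * sg (bit s ⟨i + 1, right_mem i⟩)) := by
  unfold correlator
  refine Finset.sum_congr rfl fun s _ => ?_
  rw [mul_comm]
  congr 1
  have : ∀ u v : Fin 2, (if u = v then (1 : ℝ) else -1) = sr (sg u * sg v) := by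
    intro u v
    fin_cases u <;> fin_cases v <;> simp [sg]
  exact this _ _

/-- The functional `I_k` as a linear map. -/
def functional (n : ℕ) [NeZero n] (a : ZMod n → ℤˣ) : (cycle n).Table →ₗ[ℝ] ℝ where
  toFun := cycleFunctional n a
  map_add' B C := by
    simp only [cycleFunctional, correlator_eq, Pi.add_apply, add_mul, mul_add,
      Finset.sum_add_distrib]
  map_smul' c B := by
    simp only [cycleFunctional, correlator_eq, Pi.smul_apply, smul_eq_mul, RingHom.id_apply,
      Finset.mul_sum]
    refine Finset.sum_congr rfl fun i _ => Finset.sum_congr rfl fun s _ => by ring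

theorem functional_apply (a : ZMod n → ℤˣ) (B : (cycle n).Table) :
    functional n a B = ∑ i, sr (a i) * correlator n B i := rfl

theorem sign_mul_correlator_le_one {B : (cycle n).Table} (hB : IsBehavior B) (c : ℤˣ)
    (i : ZMod n) : sr c * correlator n B i ≤ 1 := by
  rw [correlator_eq, Finset.mul_sum, ← (hB (edge n i)).2]
  refine Finset.sum_le_sum fun s _ => ?_
  have h1 := (hB (edge n i)).1 s
  have h2 := sr_le_one (c * (sg (bit s ⟨i, left_mem i⟩) * sg (bit s ⟨i + 1, right_mem i⟩)))
  rw [sr_mul] at h2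
  nlinarith

theorem functional_le {B : (cycle n).Table} (hB : IsBehavior B) (a : ZMod n → ℤˣ) :
    functional n a B ≤ n := by
  rw [functional_apply]
  refine (Finset.sum_le_sum fun i _ => sign_mul_correlator_le_one hB (a i) i).trans_eq ?_
  simp

theorem correlator_det (T : ZMod n → Fin 2) (i : ZMod n) :
    correlator n (det (Υ := cycle n) T) i = sr (sg (T i) * sg (T (i + 1))) := by
  rw [correlator_eq, sum_det_mul]
  rfl

/-- The `n` terms are signs with product `-1`, so at least one of them is `-1`. -/
theorem functional_det_le {a : ZMod n → ℤˣ} (ha : ∏ i, a i = -1) (T : ZMod n → Fin 2) :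
    functional n a (det (Υ := cycle n) T) ≤ n - 2 := by
  rw [functional_apply]
  simp only [correlator_det, ← sr_mul]
  obtain ⟨i, hi⟩ := exists_neg_of_prod (v := fun i => a i * (sg (T i) * sg (T (i + 1)))) (by
    rw [Finset.prod_mul_distrib, prod_mul_succ fun i => sg (T i), ha, mul_one])
  exact sum_le_of_le_neg_one (fun _ => sr_le_one _) (i := i) (by rw [hi]; simp)

/-! ### The contextual vertices -/

open Classical in
/-- The behavior with uniform outcomes that are perfectly (anti)correlated on each edge,
according to the signs `a`. -/
def prBox (n : ℕ) [NeZero n] (a : ZMod n → ℤˣ) : (cycle n).Table := fun γ s =>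
  if (∀ i (h : i ∈ γ.1) (h' : i + 1 ∈ γ.1), sg (bit s ⟨i, h⟩) * sg (bit s ⟨i + 1, h'⟩) = a i)
  then 1 / 2 else 0

theorem prBox_edge (hn : 3 ≤ n) (a : ZMod n → ℤˣ) (i : ZMod n)
    (s : (cycle n).Outcomes (edge n i).1) :
    prBox n a (edge n i) s =
      if sg (bit s ⟨i, left_mem i⟩) * sg (bit s ⟨i + 1, right_mem i⟩) = a i
      then 1 / 2 else 0 := by
  unfold prBox
  congr 1
  refine propext ⟨fun H => H i _ _, fun H j h h' => ?_⟩
  obtain rfl := eq_of_mem_edge hn h h'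
  exact H

/-- The case `p = q` is included because a local map may simulate two neighbouring measurements by
the same one. -/
theorem sum_prBox_mul (hn : 3 ≤ n) (a : ZMod n → ℤˣ) (j : ZMod n)
    (p q : {x // x ∈ (edge n j).1}) (G : Fin 2 → Fin 2 → ℝ) :
    ∑ s, prBox n a (edge n j) s * G (bit s p) (bit s q) =
      1 / 2 * ∑ u, G u (tw (if p.1 = q.1 then 1 else a j) u) := by
  obtain ⟨p, hp⟩ := p
  obtain ⟨q, hq⟩ := q
  simp only [sum_edge hn, prBox_edge hn, Fin.sum_univ_two]
  rcases Int.units_eq_one_or (a j) with h | h <;>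
  rcases mem_edge.1 hp with rfl | rfl <;> rcases mem_edge.1 hq with rfl | rfl <;>
  simp [h, bit_mkOut, succ_ne hn, sg, tw, (succ_ne hn _).symm] <;> ring

theorem sum_uniform_mul (hn : 3 ≤ n) (j : ZMod n)
    (p q : {x // x ∈ (edge n j).1}) (hpq : p ≠ q) (G : Fin 2 → Fin 2 → ℝ) :
    ∑ s, uniformBehavior (cycle n) (edge n j) s * G (bit s p) (bit s q) =
      1 / 4 * ∑ u, ∑ v, G u v := by
  obtain ⟨p, hp⟩ := p
  obtain ⟨q, hq⟩ := q
  have hc : Fintype.card ((cycle n).Outcomes (edge n j).1) = 4 := by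
    rw [← Fintype.card_congr (edgeEquiv hn j)]; simp
  simp only [sum_edge hn, uniformBehavior, hc, Fin.sum_univ_two]
  rcases mem_edge.1 hp with rfl | rfl <;> rcases mem_edge.1 hq with rfl | rfl <;>
  first
  | exact absurd rfl hpq
  | simp [bit_mkOut, succ_ne hn]; ring

/-- The even mixture of the two deterministic behaviors given by the signs `g` and `-g`. -/
def gaugeBox (g : ZMod n → ℤˣ) : (cycle n).Table :=
  (1 / 2 : ℝ) • det (Υ := cycle n) (fun i => bitOf (g i)) +
    (1 / 2 : ℝ) • det (Υ := cycle n) (fun i => bitOf (-g i))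

theorem gaugeBox_mem_NC (g : ZMod n → ℤˣ) : gaugeBox g ∈ NC (cycle n) :=
  convex_NC _ (det_mem_NC _) (det_mem_NC _) (by norm_num) (by norm_num) (by norm_num)

theorem det_edge (T : ZMod n → Fin 2) (i : ZMod n) (s : (cycle n).Outcomes (edge n i).1) :
    det (Υ := cycle n) T (edge n i) s =
      if T i = bit s ⟨i, left_mem i⟩ ∧ T (i + 1) = bit s ⟨i + 1, right_mem i⟩ then 1 else 0 := by
  rw [det_eq_ite]
  congr 1
  refine propext ⟨?_, fun h => ext_edge h.1.symm h.2.symm⟩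
  rintro rfl
  exact ⟨rfl, rfl⟩

theorem gaugeBox_edge (g : ZMod n → ℤˣ) (i : ZMod n) (s : (cycle n).Outcomes (edge n i).1) :
    gaugeBox g (edge n i) s =
      if sg (bit s ⟨i, left_mem i⟩) * sg (bit s ⟨i + 1, right_mem i⟩) = g i * g (i + 1)
      then 1 / 2 else 0 := by
  -- The identity is finite; stated in `ℕ` it is decidable, and it is cast to `ℝ` afterwards.
  have key : ∀ (c d : ℤˣ) (u v : Fin 2),
      (if bitOf c = u ∧ bitOf d = v then 1 else 0 : ℕ) +
        (if bitOf (-c) = u ∧ bitOf (-d) = v then 1 else 0) =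
      if sg u * sg v = c * d then 1 else 0 := by decide
  have h := key (g i) (g (i + 1)) (bit s ⟨i, left_mem i⟩) (bit s ⟨i + 1, right_mem i⟩)
  have h' := congrArg (fun k : ℕ => (1 / 2 : ℝ) * k) h
  simp only [gaugeBox, Pi.add_apply, Pi.smul_apply, smul_eq_mul, det_edge]
  push_cast at h'
  rw [← mul_add, h']
  simp

theorem prBox_edge_eq_gaugeBox (hn : 3 ≤ n) {a g : ZMod n → ℤˣ} {i : ZMod n}
    (h : g i * g (i + 1) = a i) : prBox n a (edge n i) = gaugeBox g (edge n i) := by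
  funext s
  rw [prBox_edge hn, gaugeBox_edge, h]

theorem mem_ND_of_local {Υ : Scenario} {B : Υ.Table}
    (h : ∀ γ γ', ∃ C ∈ ND Υ, B γ = C γ ∧ B γ' = C γ') : B ∈ ND Υ := by
  refine ⟨fun γ => ?_, fun γ γ' u => ?_⟩
  · obtain ⟨C, hC, h1, -⟩ := h γ γ
    rw [h1]; exact hC.1 γ
  · obtain ⟨C, hC, h1, h2⟩ := h γ γ'
    have := hC.2 γ γ' u
    simp only [marginal] at *
    rw [h1, h2]; exact this

/-- No-disturbance compares two contexts at a time. As `n ≥ 3`, some edge `j` differs from both, and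
the noncontextual gauge box cut at `j` agrees with `prBox` on the two. -/
theorem prBox_mem_ND (hn : 3 ≤ n) (a : ZMod n → ℤˣ) : prBox n a ∈ ND (cycle n) := by
  refine mem_ND_of_local fun γ γ' => ?_
  obtain ⟨i, rfl⟩ := exists_edge γ
  obtain ⟨i', rfl⟩ := exists_edge γ'
  have hcard : ({i, i'} : Finset (ZMod n)).card < (Finset.univ : Finset (ZMod n)).card := by
    rw [Finset.card_univ, ZMod.card]
    exact lt_of_le_of_lt Finset.card_le_two (by omega)
  obtain ⟨j, -, hj⟩ := Finset.exists_mem_notMem_of_card_lt_card hcard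
  simp only [Finset.mem_insert, Finset.mem_singleton, not_or] at hj
  obtain ⟨g, hg⟩ := exists_gauge a j
  exact ⟨gaugeBox g, NC_subset_ND _ (gaugeBox_mem_NC g),
    prBox_edge_eq_gaugeBox hn (hg i (Ne.symm hj.1)),
    prBox_edge_eq_gaugeBox hn (hg i' (Ne.symm hj.2))⟩

theorem card_outcomes_edge (hn : 3 ≤ n) (i : ZMod n) :
    Fintype.card ((cycle n).Outcomes (edge n i).1) = 4 := by
  rw [← Fintype.card_congr (edgeEquiv hn i)]; simp

theorem uniform_edge (hn : 3 ≤ n) (i : ZMod n) (s : (cycle n).Outcomes (edge n i).1) :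
    uniformBehavior (cycle n) (edge n i) s = 1 / 4 := by
  rw [uniformBehavior, card_outcomes_edge hn]; norm_num

theorem basePoint_pos (hn : 3 ≤ n) (a : ZMod n → ℤˣ) (i : ZMod n)
    (s : (cycle n).Outcomes (edge n i).1) : 0 < basePoint n (prBox n a) (edge n i) s := by
  have h3 : (3 : ℝ) ≤ n := by exact_mod_cast hn
  simp only [basePoint, Pi.add_apply, Pi.smul_apply, smul_eq_mul, uniform_edge hn, prBox_edge hn]
  have h1 : 0 ≤ ((n : ℝ) - 2) / n := div_nonneg (by linarith) (by linarith)
  have h2 : 0 < (2 : ℝ) / n := by positivity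
  split_ifs <;> nlinarith

/-- On each edge, `n - 1` of the gauge boxes agree with `prBox` and the one cut there has the
opposite correlation. Opposite correlations average to the uniform distribution, whence the weights
`(n-2)/n` and `2/n`; this makes `B_k'` noncontextual. -/
theorem basePoint_eq_average (hn : 3 ≤ n) {a : ZMod n → ℤˣ} (ha : ∏ i, a i = -1)
    {g : ZMod n → ZMod n → ℤˣ} (hg : ∀ j i, i ≠ j → g j i * g j (i + 1) = a i) :
    basePoint n (prBox n a) = ∑ j, (1 / n : ℝ) • gaugeBox (g j) := by
  have h3 : (3 : ℝ) ≤ n := by exact_mod_cast hn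
  funext γ s
  obtain ⟨i, rfl⟩ := exists_edge γ
  rw [Finset.sum_apply, Finset.sum_apply]
  simp only [basePoint, Pi.add_apply, Pi.smul_apply, smul_eq_mul, uniform_edge hn, prBox_edge hn,
    gaugeBox_edge]
  set σ := sg (bit s ⟨i, left_mem i⟩) * sg (bit s ⟨i + 1, right_mem i⟩) with hσ
  have h : ∀ j, (1 / n : ℝ) * (if σ = g j i * g j (i + 1) then 1 / 2 else 0) =
      (1 / n : ℝ) * (if σ = a i then 1 / 2 else 0) +
        if j = i then (1 / n : ℝ) * ((if σ = a i then 0 else 1 / 2) -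
          (if σ = a i then 1 / 2 else 0)) else 0 := by
    intro j
    by_cases hj : j = i
    · subst hj
      rw [gauge_at ha (hg j)]
      rcases Int.units_eq_one_or σ with h1 | h1 <;> rcases Int.units_eq_one_or (a j) with h2 | h2 <;>
      simp [h1, h2]
    · rw [hg j i (Ne.symm hj)]; simp [hj]
  rw [Finset.sum_congr rfl fun j _ => h j, Finset.sum_add_distrib]
  simp only [Finset.sum_const, Finset.card_univ, ZMod.card, nsmul_eq_mul, Finset.sum_ite_eq',
    Finset.mem_univ, if_true]
  split_ifs <;> field_simp <;> ring

theorem basePoint_mem_NC (hn : 3 ≤ n) {a : ZMod n → ℤˣ} (ha : ∏ i, a i = -1) :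
    basePoint n (prBox n a) ∈ NC (cycle n) := by
  choose g hg using exists_gauge a
  rw [basePoint_eq_average hn ha hg]
  have h3 : (n : ℝ) ≠ 0 := by positivity
  refine (convex_NC _).sum_mem (fun j _ => by positivity) ?_ fun j _ => gaugeBox_mem_NC _
  simp [h3]

theorem correlator_prBox (hn : 3 ≤ n) (a : ZMod n → ℤˣ) (i : ZMod n) :
    correlator n (prBox n a) i = sr (a i) := by
  rw [correlator_eq, sum_prBox_mul hn a i _ _ fun u v => sr (sg u * sg v)]
  rcases Int.units_eq_one_or (a i) with h | h <;>
  simp [h, Fin.sum_univ_two, sg, tw, (succ_ne hn i).symm] <;> norm_num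

theorem functional_prBox (hn : 3 ≤ n) (a : ZMod n → ℤˣ) : functional n a (prBox n a) = n := by
  rw [functional_apply]
  simp only [correlator_prBox hn, ← sr_mul, Int.units_mul_self]
  simp

theorem functional_uniform (hn : 3 ≤ n) (a : ZMod n → ℤˣ) :
    functional n a (uniformBehavior (cycle n)) = 0 := by
  rw [functional_apply]
  refine Finset.sum_eq_zero fun i _ => ?_
  rw [correlator_eq, sum_uniform_mul hn i _ _ (by simp [(succ_ne hn i).symm])
    fun u v => sr (sg u * sg v)]
  simp [Fin.sum_univ_two, sg]

theorem functional_basePoint (hn : 3 ≤ n) (a : ZMod n → ℤˣ) :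
    functional n a (basePoint n (prBox n a)) = n - 2 := by
  have h3 : (n : ℝ) ≠ 0 := by positivity
  rw [basePoint, map_add, map_smul, map_smul, functional_prBox hn, functional_uniform hn]
  simp [h3]

theorem functional_le_of_mem_NC {a : ZMod n → ℤˣ} (ha : ∏ i, a i = -1) {B : (cycle n).Table}
    (hB : B ∈ NC (cycle n)) : functional n a B ≤ n - 2 := by
  rw [← convexHull_range_det] at hB
  refine convexHull_min (t := {B | functional n a B ≤ n - 2}) ?_ ?_ hB
  · rintro _ ⟨T, rfl⟩; exact functional_det_le ha T
  · exact convex_halfSpace_le (functional n a).isLinear _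

theorem marginal_succ (hn : 3 ≤ n) {B : (cycle n).Table} (hB : B ∈ ND (cycle n)) (i : ZMod n) :
    B (edge n i) (mkOut i 0 0) + B (edge n i) (mkOut i 1 0) =
      B (edge n (i + 1)) (mkOut (i + 1) 0 0) + B (edge n (i + 1)) (mkOut (i + 1) 0 1) := by
  have hx : ∀ x, x ∈ (edge n i).1 ∩ (edge n (i + 1)).1 ↔ x = i + 1 := by
    intro x
    rw [Finset.mem_inter, mem_edge, mem_edge]
    constructor
    · rintro ⟨rfl | h, h' | h'⟩
      · exact h'
      · exact absurd h'.symm (succ_succ_ne hn _)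
      · exact h
      · exact h
    · rintro rfl; simp
  have h := hB.2 (edge n i) (edge n (i + 1)) fun _ => (0 : Fin 2)
  have h1 : ∀ s : (cycle n).Outcomes (edge n i).1,
      (∀ x : {x // x ∈ (edge n i).1 ∩ (edge n (i + 1)).1},
        s ⟨x.1, Finset.inter_subset_left x.2⟩ = (0 : Fin 2)) ↔
      bit s ⟨i + 1, right_mem i⟩ = 0 := fun s =>
    ⟨fun H => H ⟨i + 1, (hx _).2 rfl⟩, fun H ⟨x, h⟩ => by
      obtain rfl := (hx x).1 h; exact H⟩
  have h2 : ∀ s : (cycle n).Outcomes (edge n (i + 1)).1,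
      (∀ x : {x // x ∈ (edge n i).1 ∩ (edge n (i + 1)).1},
        s ⟨x.1, Finset.inter_subset_right x.2⟩ = (0 : Fin 2)) ↔
      bit s ⟨i + 1, left_mem (i + 1)⟩ = 0 := fun s =>
    ⟨fun H => H ⟨i + 1, (hx _).2 rfl⟩, fun H ⟨x, h⟩ => by
      obtain rfl := (hx x).1 h; exact H⟩
  simp only [marginal_eq_sum_mul, h1, h2, sum_edge hn, bit_mkOut] at h
  simpa [succ_ne hn] using h

/-- All `n` terms are at their maximum, so each edge is perfectly (anti)correlated. The bias `d i`
of measurement `i` is then carried to the next one with the sign `a i`; going once around negates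
it, so it vanishes and the table is determined. -/
theorem eq_prBox_of_functional_eq (hn : 3 ≤ n) {a : ZMod n → ℤˣ} (ha : ∏ i, a i = -1)
    {B : (cycle n).Table} (hB : B ∈ ND (cycle n)) (h : functional n a B = n) :
    B = prBox n a := by
  have hcorr : ∀ i, sr (a i) * correlator n B i = 1 := by
    have h1 := (Finset.sum_eq_sum_iff_of_le (s := Finset.univ)
      (f := fun i => sr (a i) * correlator n B i) (g := fun _ => (1 : ℝ))
      fun i _ => sign_mul_correlator_le_one hB.1 (a i) i).1
      (by rw [← functional_apply, h]; simp)
    exact fun i => h1 i (Finset.mem_univ i)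
  let d : ZMod n → ℝ := fun i => B (edge n i) (mkOut i 0 0) + B (edge n i) (mkOut i 0 1) -
    (B (edge n i) (mkOut i 1 0) + B (edge n i) (mkOut i 1 1))
  have hsum : ∀ i, B (edge n i) (mkOut i 0 0) + B (edge n i) (mkOut i 0 1) +
      (B (edge n i) (mkOut i 1 0) + B (edge n i) (mkOut i 1 1)) = 1 := fun i => by
    rw [← sum_edge hn]; exact (hB.1 (edge n i)).2
  have hc : ∀ i, sr (a i) * (B (edge n i) (mkOut i 0 0) - B (edge n i) (mkOut i 0 1) -
      B (edge n i) (mkOut i 1 0) + B (edge n i) (mkOut i 1 1)) = 1 := fun i => by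
    rw [← hcorr i, correlator_eq, sum_edge hn]
    congr 1
    simp [bit_mkOut, succ_ne hn, sg]
    ring
  have hpos : ∀ i u v, 0 ≤ B (edge n i) (mkOut i u v) := fun i u v => (hB.1 _).1 _
  have hd : ∀ i, d (i + 1) = sr (a i) * d i := by
    intro i
    have h1 := marginal_succ hn hB i
    have h2 := hsum i
    have h3 := hsum (i + 1)
    have h4 := hc i
    have h5 := hpos i 0 0
    have h6 := hpos i 0 1
    have h7 := hpos i 1 0
    have h8 := hpos i 1 1
    rcases Int.units_eq_one_or (a i) with h | h <;> rw [h] at h4 ⊢ <;>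
    simp only [sr_one, sr_neg_one] at h4 ⊢ <;> simp only [d] <;> linarith
  have hd0 : ∀ i, d i = 0 := by
    have hex : ∃ i, d i = 0 := by
      by_contra! hne
      have h1 : ∏ i, d (i + 1) = ∏ i, d i :=
        Fintype.prod_equiv (Equiv.addRight (1 : ZMod n)) _ _ fun _ => rfl
      have h2 : ∏ i, sr (a i) = -1 := by
        have := congrArg sr ha
        rw [sr_neg_one] at this
        rw [← this]
        simp [sr]
      rw [Finset.prod_congr rfl fun i _ => hd i, Finset.prod_mul_distrib, h2] at h1
      exact Finset.prod_ne_zero_iff.2 (fun i _ => hne i) (by linarith : ∏ i, d i = 0)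
    obtain ⟨i, hi⟩ := hex
    exact forall_of_succ (p := fun i => d i = 0) (fun i h => by rw [hd, h, mul_zero]) hi
  funext γ s
  obtain ⟨i, rfl⟩ := exists_edge γ
  obtain ⟨⟨u, v⟩, rfl⟩ := (edgeEquiv hn i).surjective s
  rw [prBox_edge hn]
  simp only [edgeEquiv, Equiv.coe_fn_mk, bit_mkOut, succ_ne hn, if_true, if_false]
  have h2 := hsum i
  have h4 := hc i
  have h5 := hpos i 0 0
  have h6 := hpos i 0 1
  have h7 := hpos i 1 0
  have h8 := hpos i 1 1
  have h9 := hd0 i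
  simp only [d] at h9
  rcases Int.units_eq_one_or (a i) with h | h <;> rw [h] at h4 ⊢ <;>
  simp only [sr_one, sr_neg_one] at h4 <;> fin_cases u <;> fin_cases v <;>
  simp [sg] <;> linarith

/-- A unique maximizer of a linear functional is a vertex, and the value `n` exceeds the
noncontextual bound `n - 2`. -/
theorem prBox_mem_NDC (hn : 3 ≤ n) {a : ZMod n → ℤˣ} (ha : ∏ i, a i = -1) :
    prBox n a ∈ NDC n := by
  refine ⟨mem_extremePoints_iff_left.2 ⟨prBox_mem_ND hn a, fun B hB C hC => ?_⟩, fun h => ?_⟩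
  · rintro ⟨p, q, hp, hq, hpq, h⟩
    refine eq_prBox_of_functional_eq hn ha hB ?_
    have h1 := congrArg (functional n a) h
    rw [map_add, map_smul, map_smul, functional_prBox hn, smul_eq_mul, smul_eq_mul] at h1
    have h2 := functional_le hB.1 a
    have h3 := functional_le hC.1 a
    refine le_antisymm h2 ?_
    obtain rfl : q = 1 - p := by linarith
    nlinarith
  · have := functional_le_of_mem_NC ha (extremePoints_subset h)
    rw [functional_prBox hn] at this
    linarith

theorem eq_prBox_of_mem_NDC (hn : 3 ≤ n) {a : ZMod n → ℤˣ} (ha : ∏ i, a i = -1)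
    {B : (cycle n).Table} (hB : B ∈ NDC n) (h : cycleFunctional n a B = n) : B = prBox n a :=
  eq_prBox_of_functional_eq hn ha (extremePoints_subset hB.1) h

theorem exists_extremePoint_functional (a : ZMod n → ℤˣ) (ha : ∏ i, a i = -1) :
    ∃ B ∈ (NC (cycle n)).extremePoints ℝ, cycleFunctional n a B = n - 2 := by
  -- The gauge satisfies every edge but the cut one, which costs `2`; any cut would do.
  obtain ⟨g, hg⟩ := exists_gauge a 0
  refine ⟨_, det_mem_extremePoints_NC (Υ := cycle n) fun i => bitOf (g i), ?_⟩
  change functional n a _ = _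
  rw [functional_apply]
  simp only [correlator_det, sg_bitOf, ← sr_mul]
  have h : ∀ i, sr (a i * (g i * g (i + 1))) = 1 - if i = 0 then 2 else 0 := by
    intro i
    by_cases hi : i = 0
    · subst hi
      rw [gauge_at ha hg]
      simp
      norm_num
    · rw [hg i hi]; simp [hi]
  rw [Finset.sum_congr rfl fun i _ => h i]
  simp [Finset.sum_sub_distrib]

/-! ### Local maps of the cycle acting on the contextual vertices -/

/-- The sign `sg (h 0) * sg (h 1)` is `1` for a constant relabelling and `-1` for a bijective one. A
constant paired with a bijection destroys the correlation; otherwise it is a sign, involving `ε`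
only for two bijections. -/
theorem half_sum_sign (h h' : Fin 2 → Fin 2) (ε : ℤˣ) :
    1 / 2 * ∑ u, sr (sg (h u) * sg (h' (tw ε u))) =
      if sg (h 0) * sg (h 1) = sg (h' 0) * sg (h' 1) then
        sr (sg (h 0) * sg (h' 0) * if sg (h 0) * sg (h 1) = 1 then 1 else ε)
      else 0 := by
  have key : ∀ (h h' : Fin 2 → Fin 2) (ε : ℤˣ),
      ∑ u, ((sg (h u) * sg (h' (tw ε u)) : ℤˣ) : ℤ) = 2 *
      if sg (h 0) * sg (h 1) = sg (h' 0) * sg (h' 1) then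
        ((sg (h 0) * sg (h' 0) * if sg (h 0) * sg (h 1) = 1 then 1 else ε : ℤˣ) : ℤ)
      else 0 := by decide
  have h1 := congrArg (fun z : ℤ => (1 / 2 : ℝ) * z) (key h h' ε)
  simp only [Int.cast_sum, Int.cast_mul, Int.cast_ofNat, Int.cast_ite, Int.cast_zero] at h1
  simp only [sr]
  rw [h1]
  ring

theorem half_sum_indicator (h h' : Fin 2 → Fin 2) (ε : ℤˣ) (hh : sg (h 0) * sg (h 1) = -1)
    (hh' : sg (h' 0) * sg (h' 1) = -1) (p q : Fin 2) :
    1 / 2 * ∑ u, (if h u = p ∧ h' (tw ε u) = q then 1 else 0 : ℝ) =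
      if sg p * sg q = sg (h 0) * sg (h' 0) * ε then 1 / 2 else 0 := by
  have key : ∀ (h h' : Fin 2 → Fin 2) (ε : ℤˣ), sg (h 0) * sg (h 1) = -1 →
      sg (h' 0) * sg (h' 1) = -1 → ∀ p q,
      ∑ u, (if h u = p ∧ h' (tw ε u) = q then 1 else 0 : ℕ) =
      if sg p * sg q = sg (h 0) * sg (h' 0) * ε then 1 else 0 := by decide
  have h1 := congrArg (fun z : ℕ => (1 / 2 : ℝ) * z) (key h h' ε hh hh' p q)
  push_cast at h1
  rw [h1]
  simp

theorem quarter_sum_indicator (h h' : Fin 2 → Fin 2) (hh : sg (h 0) * sg (h 1) = -1)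
    (hh' : sg (h' 0) * sg (h' 1) = -1) (p q : Fin 2) :
    1 / 4 * ∑ u, ∑ v, (if h u = p ∧ h' v = q then 1 else 0 : ℝ) = 1 / 4 := by
  have key : ∀ (h h' : Fin 2 → Fin 2), sg (h 0) * sg (h 1) = -1 →
      sg (h' 0) * sg (h' 1) = -1 → ∀ p q,
      ∑ u, ∑ v, (if h u = p ∧ h' v = q then 1 else 0 : ℕ) = 1 := by decide
  have h1 := congrArg (fun z : ℕ => (1 / 4 : ℝ) * z) (key h h' hh hh' p q)
  push_cast at h1
  rw [h1]
  simp

/-- The label of the edge measured by a local map on the edge `{i, i + 1}`. -/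
def LocalMap.edgeIndex (D : LocalMap (cycle n) (cycle n)) (i : ZMod n) : ZMod n :=
  (exists_edge (D.F (edge n i))).choose

theorem LocalMap.edge_edgeIndex (D : LocalMap (cycle n) (cycle n)) (i : ZMod n) :
    edge n (D.edgeIndex i) = D.F (edge n i) :=
  (exists_edge (D.F (edge n i))).choose_spec

/-- The outcome map of a local map between cycles. -/
def LocalMap.bitMap (D : LocalMap (cycle n) (cycle n)) (i : ZMod n) (u : Fin 2) : Fin 2 := D.h i u

/-- The correlation seen by a local map on the edge `{i, i + 1}` of a contextual vertex. -/
def LocalMap.stepSign (D : LocalMap (cycle n) (cycle n)) (a : ZMod n → ℤˣ) (i : ZMod n) : ℤˣ :=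
  if D.μ i = D.μ (i + 1) then 1 else a (D.edgeIndex i)

theorem LocalMap.sum_push_prBox (hn : 3 ≤ n) (D : LocalMap (cycle n) (cycle n))
    (a : ZMod n → ℤˣ) (i : ZMod n) (G : Fin 2 → Fin 2 → ℝ) :
    ∑ s, prBox n a (D.F (edge n i)) s * G (bit (D.mapOut (edge n i) s) ⟨i, left_mem i⟩)
        (bit (D.mapOut (edge n i) s) ⟨i + 1, right_mem i⟩) =
      1 / 2 * ∑ u, G (D.bitMap i u) (D.bitMap (i + 1) (tw (D.stepSign a i) u)) := by
  -- The context `D.F (edge n i)` is an edge only up to a propositional equality, which is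
  -- eliminated for a general `γ`.
  have h : ∀ (γ : (cycle n).Context) (j : ZMod n), edge n j = γ → ∀ (p q : {x // x ∈ γ.1})
      (G : Fin 2 → Fin 2 → ℝ), ∑ s, prBox n a γ s * G (bit s p) (bit s q) =
      1 / 2 * ∑ u, G u (tw (if p.1 = q.1 then 1 else a j) u) := by
    rintro _ j rfl p q G
    exact sum_prBox_mul hn a j p q G
  exact h _ _ (D.edge_edgeIndex i) ⟨D.μ i, D.mem _ ⟨i, left_mem i⟩⟩
    ⟨D.μ (i + 1), D.mem _ ⟨i + 1, right_mem i⟩⟩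
    fun u v => G (D.bitMap i u) (D.bitMap (i + 1) v)

theorem LocalMap.sum_push_uniform (hn : 3 ≤ n) (D : LocalMap (cycle n) (cycle n))
    (i : ZMod n) (hi : D.μ i ≠ D.μ (i + 1)) (G : Fin 2 → Fin 2 → ℝ) :
    ∑ s, uniformBehavior (cycle n) (D.F (edge n i)) s *
        G (bit (D.mapOut (edge n i) s) ⟨i, left_mem i⟩)
        (bit (D.mapOut (edge n i) s) ⟨i + 1, right_mem i⟩) =
      1 / 4 * ∑ u, ∑ v, G (D.bitMap i u) (D.bitMap (i + 1) v) := by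
  have h : ∀ (γ : (cycle n).Context) (j : ZMod n), edge n j = γ → ∀ (p q : {x // x ∈ γ.1})
      (_ : p ≠ q) (G : Fin 2 → Fin 2 → ℝ),
      ∑ s, uniformBehavior (cycle n) γ s * G (bit s p) (bit s q) = 1 / 4 * ∑ u, ∑ v, G u v := by
    rintro _ j rfl p q hpq G
    exact sum_uniform_mul hn j p q hpq G
  exact h _ _ (D.edge_edgeIndex i) ⟨D.μ i, D.mem _ ⟨i, left_mem i⟩⟩
    ⟨D.μ (i + 1), D.mem _ ⟨i + 1, right_mem i⟩⟩ (by simpa using hi)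
    fun u v => G (D.bitMap i u) (D.bitMap (i + 1) v)

theorem LocalMap.mapOut_eq_iff (D : LocalMap (cycle n) (cycle n)) (i : ZMod n)
    (s : (cycle n).Outcomes (D.F (edge n i)).1) (t : (cycle n).Outcomes (edge n i).1) :
    D.mapOut (edge n i) s = t ↔
      bit (D.mapOut (edge n i) s) ⟨i, left_mem i⟩ = bit t ⟨i, left_mem i⟩ ∧
      bit (D.mapOut (edge n i) s) ⟨i + 1, right_mem i⟩ = bit t ⟨i + 1, right_mem i⟩ :=
  ⟨by rintro rfl; exact ⟨rfl, rfl⟩, fun h => ext_edge h.1 h.2⟩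

/-- A closed walk on the cycle that rests at some step misses an edge, hence has trivial sign. -/
theorem LocalMap.prod_stepSign (D : LocalMap (cycle n) (cycle n)) (a : ZMod n → ℤˣ)
    {k : ZMod n} (hk : D.μ k = D.μ (k + 1)) : ∏ i, D.stepSign a i = 1 := by
  have hcard : ((Finset.univ.erase k).image D.edgeIndex).card <
      (Finset.univ : Finset (ZMod n)).card :=
    lt_of_le_of_lt Finset.card_image_le (Finset.card_erase_lt_of_mem (Finset.mem_univ k))
  obtain ⟨j, -, hj⟩ := Finset.exists_mem_notMem_of_card_lt_card hcard
  obtain ⟨g, hg⟩ := exists_gauge a j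
  -- In a gauge cut at the unused edge `j`, each step sign is the ratio of the gauge at its two
  -- ends, so the product telescopes around the walk.
  rw [← prod_mul_succ fun i => g (D.μ i)]
  refine Finset.prod_congr rfl fun i _ => ?_
  unfold LocalMap.stepSign
  split_ifs with h
  · rw [← h, Int.units_mul_self]
  · have hi : i ≠ k := by rintro rfl; exact h hk
    have he : D.edgeIndex i ≠ j := by
      rintro rfl
      exact hj (Finset.mem_image_of_mem _ (Finset.mem_erase.2 ⟨hi, Finset.mem_univ i⟩))
    have h1 : D.μ i ∈ (edge n (D.edgeIndex i)).1 := by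
      rw [D.edge_edgeIndex]; exact D.mem _ ⟨i, left_mem i⟩
    have h2 : D.μ (i + 1) ∈ (edge n (D.edgeIndex i)).1 := by
      rw [D.edge_edgeIndex]; exact D.mem _ ⟨i + 1, right_mem i⟩
    rw [← hg _ he]
    rcases mem_edge.1 h1 with h1 | h1 <;> rcases mem_edge.1 h2 with h2 | h2
    · exact absurd (h1.trans h2.symm) h
    · rw [h1, h2]
    · rw [h1, h2, mul_comm]
    · exact absurd (h1.trans h2.symm) h

/-- Every edge of the image contributes `0` or a sign. Zeros occur where constant and bijective
relabellings (`τ = 1` and `τ = -1`) meet, hence at least twice if at all; two zeros or one `-1`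
already cost `2`. If neither occurs, all contributions are `1`, and parity excludes constant
relabellings and resting steps. -/
theorem LocalMap.push_dichotomy (hn : 3 ≤ n) {a : ZMod n → ℤˣ} (ha : ∏ i, a i = -1)
    (D : LocalMap (cycle n) (cycle n)) :
    functional n a (D.push (prBox n a)) ≤ n - 2 ∨
      (D.push (prBox n a) = prBox n a ∧
        D.push (basePoint n (prBox n a)) = basePoint n (prBox n a)) := by
  let c : ZMod n → ℤˣ := fun i => sg (D.bitMap i 0)
  let τ : ZMod n → ℤˣ := fun i => sg (D.bitMap i 0) * sg (D.bitMap i 1)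
  let κ : ZMod n → ℤˣ := fun i =>
    a i * (c i * c (i + 1) * if τ i = 1 then 1 else D.stepSign a i)
  have hv : ∀ i, sr (a i) * correlator n (D.push (prBox n a)) i =
      if τ i = τ (i + 1) then sr (κ i) else 0 := by
    intro i
    rw [correlator_eq, D.sum_push_mul _ _ fun t =>
      sr (sg (bit t ⟨i, left_mem i⟩) * sg (bit t ⟨i + 1, right_mem i⟩)),
      D.sum_push_prBox hn a i fun u v => sr (sg u * sg v), half_sum_sign, mul_ite, mul_zero,
      ← sr_mul]
  have hv1 : ∀ i, (if τ i = τ (i + 1) then sr (κ i) else 0) ≤ 1 := by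
    intro i
    split_ifs
    · exact sr_le_one _
    · norm_num
  rw [functional_apply, Finset.sum_congr rfl fun i _ => hv i]
  by_cases hsw : ∃ i, τ i ≠ τ (i + 1)
  · left
    obtain ⟨i, hi⟩ := hsw
    have hneg : ∀ x y : ℤˣ, x * y = -1 ↔ x ≠ y := by decide
    obtain ⟨j, hji, hj⟩ := prod_neg_one_of_exists_unique (prod_mul_succ τ) ((hneg _ _).2 hi)
    exact sum_le_of_two_nonpos hv1 hji (by rw [if_neg ((hneg _ _).1 hj)]) (by rw [if_neg hi])
  push Not at hsw
  by_cases hκ : ∃ i, κ i = -1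
  · left
    obtain ⟨i, hi⟩ := hκ
    exact sum_le_of_le_neg_one hv1 (i := i) (by rw [if_pos (hsw i), hi]; simp)
  right
  have hκ1 : ∀ i, κ i = 1 := fun i =>
    (Int.units_eq_one_or _).resolve_right fun h => hκ ⟨i, h⟩
  -- In the product of all `κ i = 1`, the factors `c i * c (i + 1)` cancel around the cycle and the
  -- `a i` leave `-1`.
  have hprod : ∏ i, (if τ i = 1 then 1 else D.stepSign a i) = -1 := by
    have h1 : ∏ i, κ i = 1 := Finset.prod_eq_one fun i _ => hκ1 i
    simp only [κ, Finset.prod_mul_distrib (f := a), Finset.prod_mul_distrib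
      (f := fun i => c i * c (i + 1)), prod_mul_succ, ha, one_mul] at h1
    rw [← neg_neg (∏ i, _), ← neg_one_mul (∏ i, _), h1]
  have hτ : ∀ i, τ i = -1 := by
    have h0 : ∃ i, τ i = -1 := by
      by_contra! h
      rw [Finset.prod_eq_one fun i _ => if_pos ((Int.units_eq_one_or _).resolve_right (h i))]
        at hprod
      exact absurd hprod (by decide)
    obtain ⟨i, hi⟩ := h0
    exact forall_of_succ (p := fun i => τ i = -1) (fun i h => by rw [← hsw i, h]) hi
  have hif : ∀ i, (if τ i = 1 then 1 else D.stepSign a i) = D.stepSign a i := fun i =>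
    if_neg (by rw [hτ i]; decide)
  have hstep : ∀ i, D.μ i ≠ D.μ (i + 1) := by
    intro i hi
    rw [Finset.prod_congr rfl fun i _ => hif i, D.prod_stepSign a hi] at hprod
    exact absurd hprod (by decide)
  have hsign : ∀ i, c i * c (i + 1) * D.stepSign a i = a i := by
    intro i
    have h1 := hκ1 i
    simp only [κ, hif] at h1
    exact (by decide : ∀ x y : ℤˣ, x * y = 1 → y = x) _ _ h1
  have hpr : D.push (prBox n a) = prBox n a := by
    funext γ t
    obtain ⟨i, rfl⟩ := exists_edge γ
    simp only [LocalMap.push_apply, D.mapOut_eq_iff]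
    rw [D.sum_push_prBox hn a i fun u v => if u = bit t ⟨i, left_mem i⟩ ∧
      v = bit t ⟨i + 1, right_mem i⟩ then 1 else 0, half_sum_indicator _ _ _ (hτ i) (hτ (i + 1)),
      prBox_edge hn]
    congr 2
    exact hsign i
  -- Because no step rests, neighbouring targets read distinct, hence independent uniform bits,
  -- relabelled bijectively.
  have hun : D.push (uniformBehavior (cycle n)) = uniformBehavior (cycle n) := by
    funext γ t
    obtain ⟨i, rfl⟩ := exists_edge γ
    simp only [LocalMap.push_apply, D.mapOut_eq_iff]
    rw [D.sum_push_uniform hn i (hstep i) fun u v => if u = bit t ⟨i, left_mem i⟩ ∧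
      v = bit t ⟨i + 1, right_mem i⟩ then 1 else 0,
      quarter_sum_indicator _ _ (hτ i) (hτ (i + 1)), uniform_edge hn]
  refine ⟨hpr, ?_⟩
  rw [basePoint, map_add, map_smul, map_smul, hpr, hun]

theorem basePoint_nonneg (hn : 3 ≤ n) (a : ZMod n → ℤˣ) (γ : (cycle n).Context)
    (s : (cycle n).Outcomes γ.1) : 0 ≤ basePoint n (prBox n a) γ s := by
  obtain ⟨i, rfl⟩ := exists_edge γ
  exact (basePoint_pos hn a i s).le

/-- Here `w` is the total weight of the local maps fixing both `B_k` and `B_k'`. The other maps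
contribute at most `n - 2` per unit weight to the functional at `B_k`, and only nonnegative amounts
to the entries. -/
theorem WiringData.IsNoncontextual.exists_weight (hn : 3 ≤ n) {a : ZMod n → ℤˣ}
    (ha : ∏ i, a i = -1) {W : WiringData (cycle n) (cycle n)} (hW : W.IsNoncontextual) :
    ∃ L : (cycle n).Table →ₗ[ℝ] (cycle n).Table, (∀ B, W.apply B = L B) ∧
      (∀ B : (cycle n).Table, (∀ γ s, 0 ≤ B γ s) → ∀ γ s, 0 ≤ L B γ s) ∧
      (∀ B ∈ NC (cycle n), functional n a (L B) ≤ n - 2) ∧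
      ∃ w : ℝ, w ≤ 1 ∧ functional n a (L (prBox n a)) ≤ n - 2 + 2 * w ∧
        (∀ γ s, w * prBox n a γ s ≤ L (prBox n a) γ s) ∧
        ∀ γ s, w * basePoint n (prBox n a) γ s ≤ L (basePoint n (prBox n a)) γ s := by
  classical
  obtain ⟨ι, _, w, D, hw, hw1, hWD⟩ := hW.exists_localMap_decomposition
  let good : ι → Prop := fun i => (D i).push (prBox n a) = prBox n a ∧
    (D i).push (basePoint n (prBox n a)) = basePoint n (prBox n a)
  have happ : ∀ (B : (cycle n).Table) γ s, (∑ i, w i • (D i).push : _ →ₗ[ℝ] _) B γ s =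
      ∑ i, w i * (D i).push B γ s := by
    intro B γ s
    simp [LinearMap.sum_apply, Finset.sum_apply]
  have hge : ∀ B : (cycle n).Table, (∀ γ s, 0 ≤ B γ s) → (∀ i, good i → (D i).push B = B) →
      ∀ γ s, (∑ i, if good i then w i else 0) * B γ s ≤
        (∑ i, w i • (D i).push : _ →ₗ[ℝ] _) B γ s := by
    intro B hB hgood γ s
    rw [happ, Finset.sum_mul]
    refine Finset.sum_le_sum fun i _ => ?_
    split_ifs with h
    · rw [hgood i h]
    · rw [zero_mul]; exact mul_nonneg (hw i) ((D i).push_nonneg hB γ s)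
  refine ⟨∑ i, w i • (D i).push, fun B => ?_, fun B hB γ s => ?_, fun B hB => ?_,
    ∑ i, if good i then w i else 0, ?_, ?_, ?_, ?_⟩
  · rw [hWD]; simp [LinearMap.sum_apply]
  · rw [happ]
    exact Finset.sum_nonneg fun i _ => mul_nonneg (hw i) ((D i).push_nonneg hB γ s)
  · rw [← convexHull_range_det] at hB
    refine convexHull_min (t := {B | functional n a ((∑ i, w i • (D i).push : _ →ₗ[ℝ] _) B)
      ≤ n - 2}) ?_ ?_ hB
    · rintro _ ⟨T, rfl⟩
      simp only [Set.mem_ofPred_eq, LinearMap.sum_apply, LinearMap.smul_apply, map_sum, map_smul,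
        LocalMap.push_det, smul_eq_mul]
      calc _ ≤ ∑ i, w i * ((n : ℝ) - 2) := Finset.sum_le_sum fun i _ =>
            mul_le_mul_of_nonneg_left (functional_det_le ha _) (hw i)
        _ = _ := by rw [← Finset.sum_mul, hw1, one_mul]
    · exact convex_halfSpace_le (functional n a ∘ₗ (∑ i, w i • (D i).push)).isLinear _
  · rw [← hw1]
    refine Finset.sum_le_sum fun i _ => ?_
    split_ifs
    · exact le_rfl
    · exact hw i
  · simp only [LinearMap.sum_apply, LinearMap.smul_apply, map_sum, map_smul, smul_eq_mul]
    calc _ ≤ ∑ i, (w i * ((n : ℝ) - 2) + 2 * if good i then w i else 0) := by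
          refine Finset.sum_le_sum fun i _ => ?_
          split_ifs with h
          · rw [h.1, functional_prBox hn]; linarith
          · rw [mul_zero, add_zero]
            exact mul_le_mul_of_nonneg_left (((D i).push_dichotomy hn ha).resolve_right h) (hw i)
      _ = _ := by
          rw [Finset.sum_add_distrib, ← Finset.sum_mul, hw1, one_mul, ← Finset.mul_sum]
  · exact hge _ (fun γ s => ((prBox_mem_ND hn a).1 γ).1 s) fun i h => h.1
  · exact hge _ (basePoint_nonneg hn a) fun i h => h.2

end Cycle

/-! ### Mixing with a noncontextual behavior -/

/-- The scenario with one context, containing all measurements, and trivial outcomes. -/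
abbrev trivialScenario (M : Type) [Fintype M] [DecidableEq M] : Scenario where
  M := M
  contexts := {Finset.univ}
  maximal := by simp
  O := fun _ => Unit

/-- Keep an outcome, or replace it by a given one. -/
def replaceOutcome {α : Type} (r : Option α) (o : α) : α := r.getD o

/-- The wiring that replaces each outcome by the outcome of the pre-processing box, if any. -/
abbrev replaceWiring (Υ : Scenario) (pre : (Υ.withOutcomes fun x => Option (Υ.O x)).Table) :
    WiringData Υ Υ where
  R x := Option (Υ.O x)
  pre := pre
  f β _ := β
  component _ _ x := x
  Pos β _ := trivialScenario {x // x ∈ β.1}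
  pos _ _ := det fun _ => ()
  g _ _ x _ := x
  g_context β _ _ := by simp
  out _ r x o _ := replaceOutcome (r x) o

theorem replaceWiring_post (Υ : Scenario) (pre : (Υ.withOutcomes fun x => Option (Υ.O x)).Table)
    (β : Υ.Context) (r : (replaceWiring Υ pre).PreOutcomes β) (s t : Υ.Outcomes β.1) :
    (replaceWiring Υ pre).post β r s t =
      ∏ x : {x // x ∈ β.1}, if replaceOutcome (r x) (s x) = t x then 1 else 0 := by
  unfold WiringData.post
  refine (Finset.sum_eq_single (fun _ => ()) (fun q _ hq => absurd rfl hq) (by simp)).trans ?_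
  rw [Finset.prod_ite_zero, Finset.prod_const_one]
  simp [det]

theorem replaceWiring_isNoncontextual (Υ : Scenario)
    {pre : (Υ.withOutcomes fun x => Option (Υ.O x)).Table} (hpre : pre ∈ NC _) :
    (replaceWiring Υ pre).IsNoncontextual where
  pre_nc := hpre
  pos_nc β _ := det_mem_NC (Υ := trivialScenario {x // x ∈ β.1}) fun _ => ()
  component_local := ⟨fun x _ => x, fun _ _ _ _ => rfl⟩
  factorizable := by
    classical
    -- A response must be defined for an outcome of any measurement; only the label `x` itself ever
    -- reaches component `x`, so the arbitrary value is never used.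
    refine ⟨Unit, inferInstance, fun _ => 1, fun _ x ρ o t =>
      if replaceOutcome ρ (if h : o.1 = x then h ▸ o.2 else Classical.arbitrary _) = t
      then 1 else 0, fun _ => zero_le_one, by simp, fun _ x ρ o => ⟨fun t => ?_, ?_⟩,
      fun β r s t => ?_⟩
    · positivity
    · simp
    · refine (replaceWiring_post Υ pre β r s t).trans ?_
      simp

/-- The probability of `t` once the pre-processing box has returned `r`. -/
def replaceSum {Υ : Scenario} (B : Υ.Table) (β : Υ.Context) (t : Υ.Outcomes β.1)
    (r : (Υ.withOutcomes fun x => Option (Υ.O x)).Outcomes β.1) : ℝ :=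
  ∑ s : Υ.Outcomes β.1, B β s *
    ∏ x : {x // x ∈ β.1}, if replaceOutcome (r x) (s x) = t x then 1 else 0

theorem replaceSum_none {Υ : Scenario} (B : Υ.Table) (β : Υ.Context) (t : Υ.Outcomes β.1) :
    replaceSum B β t (restr (Υ := Υ.withOutcomes fun x => Option (Υ.O x)) (fun _ => none) β.1) =
      B β t := by
  unfold replaceSum
  rw [Finset.sum_eq_single t]
  · simp [restr, replaceOutcome]
  · intro s _ hs
    obtain ⟨x, hx⟩ := Function.ne_iff.1 hs
    rw [Finset.prod_eq_zero (Finset.mem_univ x) (if_neg hx), mul_zero]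
  · simp

theorem replaceSum_some {Υ : Scenario} {B : Υ.Table} (hB : IsBehavior B) (T : ∀ x, Υ.O x)
    (β : Υ.Context) (t : Υ.Outcomes β.1) :
    replaceSum B β t
      (restr (Υ := Υ.withOutcomes fun x => Option (Υ.O x)) (fun x => some (T x)) β.1) =
      det T β t := by
  have h : det T β t = ∏ x : {x // x ∈ β.1}, if T x = t x then 1 else 0 := by
    rw [Finset.prod_ite_zero]
    simp [det]
  rw [h]
  change ∑ s, B β s * (∏ x : {x // x ∈ β.1}, if T x = t x then 1 else 0) = _
  rw [← Finset.sum_mul, (hB β).2, one_mul]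

/-- The pre-processing box supplies shared randomness: with probability `p` it tells all components
to keep their outcomes, otherwise it hands them a global assignment sampled from a model of `N`. -/
theorem converts_mix {Υ : Scenario} (B C : {B : Υ.Table // B ∈ ND Υ}) {N : Υ.Table}
    (hN : N ∈ NC Υ) {p : ℝ} (hp : 0 ≤ p) (hp1 : p ≤ 1) (hC : C.1 = p • B.1 + (1 - p) • N) :
    Converts ⟨Υ, B⟩ ⟨Υ, C⟩ := by
  obtain ⟨P, hP, hP1, rfl⟩ := (mem_NC_iff N).1 hN
  let Υo := Υ.withOutcomes fun x => Option (Υ.O x)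
  let pre : Υo.Table := p • det (Υ := Υo) (fun _ => none) +
    (1 - p) • ∑ T, P T • det (Υ := Υo) fun x => some (T x)
  have hpre : pre ∈ NC Υo := by
    refine convex_NC Υo (det_mem_NC _) ?_ hp (by linarith) (by ring)
    exact (convex_NC Υo).sum_mem (fun T _ => hP T) hP1 fun T _ => det_mem_NC _
  refine ⟨replaceWiring Υ pre, replaceWiring_isNoncontextual Υ hpre, ?_⟩
  have key : ∀ (β : Υ.Context) (t : Υ.Outcomes β.1), (replaceWiring Υ pre).apply B.1 β t =
      p * B.1 β t + (1 - p) * ∑ T, P T * det T β t := by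
    intro β t
    have h1 : (replaceWiring Υ pre).apply B.1 β t = ∑ r, pre β r * replaceSum B.1 β t r := by
      refine Finset.sum_congr rfl fun r _ => ?_
      congr 1
      exact Finset.sum_congr rfl fun s _ => by rw [← replaceWiring_post Υ pre]
    rw [h1]
    simp only [pre, Pi.add_apply, Pi.smul_apply, Finset.sum_apply, smul_eq_mul, add_mul,
      Finset.sum_add_distrib, mul_assoc, ← Finset.mul_sum, sum_det_mul, Finset.sum_mul]
    rw [Finset.sum_comm]
    simp only [← Finset.mul_sum, sum_det_mul]
    congr 2
    · exact replaceSum_none B.1 β t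
    · exact Finset.sum_congr rfl fun T _ =>
        congrArg (P T * ·) (replaceSum_some B.2.1 T β t)
  change _ = C.1
  rw [hC]
  funext β t
  refine (key β t).trans ?_
  simp [Finset.sum_apply]

/-! ### Convertibility along the two segments -/

section Cycle

variable {n : ℕ} [NeZero n]

theorem functional_segmentPoint (hn : 3 ≤ n) (a : ZMod n → ℤˣ) (ε : ℝ) :
    functional n a (segmentPoint n (prBox n a) ε) = n - 2 + 2 * ε := by
  rw [segmentPoint, map_add, map_smul, map_smul, functional_prBox hn, functional_basePoint hn,
    smul_eq_mul, smul_eq_mul]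
  ring

theorem functional_twoParam (hn : 3 ≤ n) (a : ZMod n → ℤˣ) {Bt : (cycle n).Table}
    (hBt : functional n a Bt = n - 2) (x : ℝ) :
    functional n a (twoParam n (prBox n a) Bt x x) = n - 2 + 2 * (x * (1 - x)) := by
  rw [twoParam, map_add, map_smul, map_smul, functional_segmentPoint hn, hBt,
    smul_eq_mul, smul_eq_mul]
  ring

theorem segmentPoint_mem_ND (hn : 3 ≤ n) {a : ZMod n → ℤˣ} (ha : ∏ i, a i = -1) {ε : ℝ}
    (hε : ε ∈ Set.Icc (0 : ℝ) 1) : segmentPoint n (prBox n a) ε ∈ ND (cycle n) :=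
  convex_ND _ (prBox_mem_ND hn a) (NC_subset_ND _ (basePoint_mem_NC hn ha)) hε.1
    (sub_nonneg.2 hε.2) (add_sub_cancel _ _)

theorem twoParam_mem_ND (hn : 3 ≤ n) {a : ZMod n → ℤˣ} (ha : ∏ i, a i = -1)
    {Bt : (cycle n).Table} (hBt : Bt ∈ NC (cycle n)) {x : ℝ} (hx : x ∈ Set.Icc (0 : ℝ) 1) :
    twoParam n (prBox n a) Bt x x ∈ ND (cycle n) :=
  convex_ND _ (NC_subset_ND _ hBt) (segmentPoint_mem_ND hn ha hx) hx.1
    (sub_nonneg.2 hx.2) (add_sub_cancel _ _)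

/-- The functional cannot be raised by a noncontextual wiring along the segment `P_k`. -/
theorem not_converts_segmentPoint (hn : 3 ≤ n) {a : ZMod n → ℤˣ} (ha : ∏ i, a i = -1)
    {ε ε' : ℝ} (hε : 0 ≤ ε) (h1 : ε ≤ 1) (hlt : ε < ε')
    (B C : {B : (cycle n).Table // B ∈ ND (cycle n)})
    (hB : B.1 = segmentPoint n (prBox n a) ε) (hC : C.1 = segmentPoint n (prBox n a) ε') :
    ¬ Converts ⟨cycle n, B⟩ ⟨cycle n, C⟩ := by
  rintro ⟨W, hW, h⟩
  obtain ⟨L, hL, -, hNC, w, hw1, hI, -, -⟩ := hW.exists_weight hn ha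
  have h2 := congrArg (functional n a) h
  simp only at h2
  rw [hL, hB, hC, functional_segmentPoint hn, segmentPoint, map_add, map_add, map_smul, map_smul,
    map_smul, map_smul, smul_eq_mul, smul_eq_mul] at h2
  have h3 := hNC _ (basePoint_mem_NC hn ha)
  -- The image has functional at most `ε (n - 2 + 2w) + (1 - ε)(n - 2) ≤ n - 2 + 2ε`, less than
  -- required at `ε'`.
  nlinarith [mul_le_mul_of_nonneg_left hI hε, mul_le_mul_of_nonneg_left h3 (sub_nonneg.2 h1),
    mul_le_mul_of_nonneg_left hw1 hε]

theorem converts_segmentPoint (hn : 3 ≤ n) {a : ZMod n → ℤˣ} (ha : ∏ i, a i = -1)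
    {ε ε' : ℝ} (hε : 0 ≤ ε) (hlt : ε < ε')
    (B C : {B : (cycle n).Table // B ∈ ND (cycle n)})
    (hB : B.1 = segmentPoint n (prBox n a) ε) (hC : C.1 = segmentPoint n (prBox n a) ε') :
    Converts ⟨cycle n, C⟩ ⟨cycle n, B⟩ := by
  have h0 : 0 < ε' := hε.trans_lt hlt
  refine converts_mix C B (basePoint_mem_NC hn ha) (p := ε / ε') (div_nonneg hε h0.le)
    ((div_le_one h0).2 hlt.le) ?_
  have h1 : ε = ε / ε' * ε' := (div_mul_cancel₀ ε h0.ne').symm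
  rw [hB, hC, segmentPoint, segmentPoint]
  generalize ε / ε' = p at h1
  subst h1
  module

theorem not_converts_twoParam (hn : 3 ≤ n) {a : ZMod n → ℤˣ} (ha : ∏ i, a i = -1)
    {Bt : (cycle n).Table} (hBt : Bt ∈ (NC (cycle n)).extremePoints ℝ)
    (hI : functional n a Bt = n - 2) {x y : ℝ} (hx : x ∈ Set.Ico (1 / 2 : ℝ) 1)
    (hy : y ∈ Set.Ico (1 / 2 : ℝ) 1) (hxy : x ≠ y)
    (B C : {B : (cycle n).Table // B ∈ ND (cycle n)})
    (hB : B.1 = twoParam n (prBox n a) Bt x x) (hC : C.1 = twoParam n (prBox n a) Bt y y) :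
    ¬ Converts ⟨cycle n, B⟩ ⟨cycle n, C⟩ := by
  rintro ⟨W, hW, h⟩
  obtain ⟨hx0, hx1⟩ := hx
  obtain ⟨hy0, hy1⟩ := hy
  obtain ⟨L, hL, hpos, hNC, w, hw1, hLI, hLpr, hLb⟩ := hW.exists_weight hn ha
  have h' : L (twoParam n (prBox n a) Bt x x) = twoParam n (prBox n a) Bt y y := by
    rw [← hB, ← hC, ← hL]; exact h
  have hx2 : 0 ≤ x * (1 - x) := mul_nonneg (by linarith) (by linarith)
  have hBtN := extremePoints_subset hBt
  have hexp : L (twoParam n (prBox n a) Bt x x) = x • L Bt + ((x * (1 - x)) • L (prBox n a) +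
      ((1 - x) * (1 - x)) • L (basePoint n (prBox n a))) := by
    simp only [twoParam, segmentPoint, map_add, map_smul]
    module
  -- Of the three components of the source, only `B_k` can keep a value above `n - 2`, and only
  -- through the weight `w`.
  have hw : y * (1 - y) ≤ w * (x * (1 - x)) := by
    have h2 := congrArg (functional n a) h'
    rw [hexp, functional_twoParam hn a hI] at h2
    simp only [map_add, map_smul, smul_eq_mul] at h2
    have h3 := mul_le_mul_of_nonneg_left (hNC _ hBtN) (by linarith : 0 ≤ x)
    have h4 := mul_le_mul_of_nonneg_left (hNC _ (basePoint_mem_NC hn ha))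
      (mul_nonneg (by linarith) (by linarith) : 0 ≤ (1 - x) * (1 - x))
    have h5 := mul_le_mul_of_nonneg_left hLI hx2
    nlinarith
  rcases lt_or_gt_of_ne hxy with hlt | hlt
  · obtain ⟨T, rfl⟩ := exists_det_of_mem_extremePoints_NC hBt
    -- Flipping the first bit of `T` gives an outcome of probability zero in `B̃`; the second bit is
    -- immaterial.
    let s : (cycle n).Outcomes (edge n 0).1 := mkOut 0 (1 - T 0) 0
    have hs : det T (edge n 0) s = 0 := by
      have := det_edge T 0 s
      rw [this, if_neg]
      rintro ⟨h1, -⟩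
      simp only [s, bit_mkOut, if_true] at h1
      exact (by decide : ∀ u : Fin 2, u ≠ 1 - u) _ h1
    have h2 := congrFun (congrFun h' (edge n 0)) s
    rw [hexp] at h2
    simp only [twoParam, segmentPoint, Pi.add_apply, Pi.smul_apply, smul_eq_mul, hs] at h2
    have h3 := hpos (det T) (fun γ => ((det_mem_ND T).1 γ).1) (edge n 0) s
    have h4 := hLpr (edge n 0) s
    have h5 := hLb (edge n 0) s
    have h6 := basePoint_pos hn a 0 s
    have h7 := ((prBox_mem_ND hn a).1 (edge n 0)).1 s
    generalize prBox n a (edge n 0) s = b1 at *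
    generalize basePoint n (prBox n a) (edge n 0) s = b0 at *
    have h8 : w * (x * (1 - x)) * b1 + w * ((1 - x) * (1 - x)) * b0 ≤
        (1 - y) * (y * b1 + (1 - y) * b0) := by
      nlinarith [mul_nonneg (by linarith : 0 ≤ x) h3, mul_le_mul_of_nonneg_left h4 hx2,
        mul_le_mul_of_nonneg_left h5 (mul_nonneg (by linarith) (by linarith) :
          0 ≤ (1 - x) * (1 - x))]
    -- By `hw` the `b1` terms of `h8` can be dropped, and `b0 > 0` is then divided out.
    have h9 : w * ((1 - x) * (1 - x)) * b0 ≤ (1 - y) * (1 - y) * b0 := by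
      nlinarith [mul_le_mul_of_nonneg_right hw h7]
    have h10 : w * ((1 - x) * (1 - x)) ≤ (1 - y) * (1 - y) := le_of_mul_le_mul_right h9 h6
    have h11 : y * (1 - y) * (1 - x) ≤ x * ((1 - y) * (1 - y)) := by
      nlinarith [mul_le_mul_of_nonneg_right hw (by linarith : 0 ≤ 1 - x),
        mul_le_mul_of_nonneg_left h10 (by linarith : 0 ≤ x)]
    have h12 : y * (1 - x) ≤ x * (1 - y) :=
      le_of_mul_le_mul_right (by linarith) (by linarith : 0 < 1 - y)
    linarith
  -- For `1/2 ≤ y < x`, `y(1-y) > x(1-x)`, against `hw` and `w ≤ 1`.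
  · nlinarith [mul_le_mul_of_nonneg_right hw1 hx2]

/-! ### Cardinalities, and the chain and antichain -/

theorem mk_objects_image {Υ : Scenario} {f : ℝ → Υ.Table} {s : Set ℝ} (hs : #s = 𝔠)
    (hf : Set.InjOn f s) (hND : f '' s ⊆ ND Υ) : #(objects Υ (f '' s)) = 𝔠 := by
  let F : s → Obj := fun x => ⟨Υ, f x, hND ⟨x, x.2, rfl⟩⟩
  have hF : Function.Injective F := by
    intro x y hxy
    have h1 : f x = f y := by simpa [F] using hxy
    exact Subtype.ext (hf x.2 y.2 h1)
  have hr : objects Υ (f '' s) = Set.range F := by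
    ext X
    constructor
    · rintro ⟨B, ⟨x, hx, hB⟩, rfl⟩
      refine ⟨⟨x, hx⟩, ?_⟩
      have : B = ⟨f x, hND ⟨x, hx, rfl⟩⟩ := Subtype.ext hB.symm
      rw [this]
    · rintro ⟨x, rfl⟩
      exact ⟨⟨f x, hND ⟨x, x.2, rfl⟩⟩, ⟨x, x.2, rfl⟩, rfl⟩
  rw [hr]
  have := Cardinal.mk_range_eq_of_injective hF
  rw [hs] at this
  simpa using this

theorem segmentP_eq_image (B : (cycle n).Table) :
    segmentP n B = segmentPoint n B '' Set.Icc 0 1 := by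
  ext C; simp only [segmentP, Set.mem_image, eq_comm]; rfl

theorem diagonal_eq_image (B Bt : (cycle n).Table) :
    diagonal n B Bt = (fun x => twoParam n B Bt x x) '' Set.Ico (1 / 2) 1 := by
  ext C; simp only [diagonal, Set.mem_image, eq_comm]; rfl

theorem segmentP_chain (hn : 3 ≤ n) {a : ZMod n → ℤˣ} (ha : ∏ i, a i = -1) :
    segmentP n (prBox n a) ⊆ ND (cycle n) ∧
      #(objects (cycle n) (segmentP n (prBox n a))) = 𝔠 ∧
      IsNCWChain (objects (cycle n) (segmentP n (prBox n a))) := by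
  have hND : segmentPoint n (prBox n a) '' Set.Icc 0 1 ⊆ ND (cycle n) := by
    rintro _ ⟨ε, hε, rfl⟩; exact segmentPoint_mem_ND hn ha hε
  rw [segmentP_eq_image]
  refine ⟨hND, mk_objects_image (Cardinal.mk_Icc_real zero_lt_one) ?_ hND, ?_⟩
  · intro ε _ ε' _ h
    have := congrArg (functional n a) h
    rw [functional_segmentPoint hn, functional_segmentPoint hn] at this
    linarith
  · rintro _ ⟨B, ⟨ε, hε, hB⟩, rfl⟩ _ ⟨C, ⟨ε', hε', hC⟩, rfl⟩ hne
    rcases lt_trichotomy ε ε' with h | rfl | h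
    · exact Or.inr ⟨converts_segmentPoint hn ha hε.1 h B C hB.symm hC.symm,
        not_converts_segmentPoint hn ha hε.1 hε.2 h B C hB.symm hC.symm⟩
    · exact absurd (by rw [Subtype.ext (hB.symm.trans hC)]) hne
    · exact Or.inl ⟨converts_segmentPoint hn ha hε'.1 h C B hC.symm hB.symm,
        not_converts_segmentPoint hn ha hε'.1 hε'.2 h C B hC.symm hB.symm⟩

theorem diagonal_antichain (hn : 3 ≤ n) {a : ZMod n → ℤˣ} (ha : ∏ i, a i = -1)
    {Bt : (cycle n).Table} (hBt : Bt ∈ (NC (cycle n)).extremePoints ℝ)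
    (hI : cycleFunctional n a Bt = n - 2) :
    diagonal n (prBox n a) Bt ⊆ ND (cycle n) ∧
      #(objects (cycle n) (diagonal n (prBox n a) Bt)) = 𝔠 ∧
      IsNCWAntichain (objects (cycle n) (diagonal n (prBox n a) Bt)) := by
  change functional n a Bt = n - 2 at hI
  have hND : (fun x => twoParam n (prBox n a) Bt x x) '' Set.Ico (1 / 2) 1 ⊆ ND (cycle n) := by
    rintro _ ⟨x, hx, rfl⟩
    exact twoParam_mem_ND hn ha (extremePoints_subset hBt) ⟨by linarith [hx.1], hx.2.le⟩
  rw [diagonal_eq_image]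
  refine ⟨hND, mk_objects_image (Cardinal.mk_Ico_real (by norm_num)) ?_ hND, ?_⟩
  -- The functional separates the points, since `x(1-x)` is injective on `[1/2, 1)`.
  · intro x hx y hy h
    have := congrArg (functional n a) h
    simp only [functional_twoParam hn a hI] at this
    by_contra hne
    have hx1 := hx.1
    have hy1 := hy.1
    rcases lt_or_gt_of_ne hne with h | h <;> nlinarith
  · rintro _ ⟨B, ⟨x, hx, hB⟩, rfl⟩ _ ⟨C, ⟨y, hy, hC⟩, rfl⟩ hne
    have hxy : x ≠ y := by
      rintro rfl
      exact hne (by rw [Subtype.ext (hB.symm.trans hC)])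
    exact ⟨not_converts_twoParam hn ha hBt hI hx hy hxy B C hB.symm hC.symm,
      not_converts_twoParam hn ha hBt hI hy hx hxy.symm C B hC.symm hB.symm⟩

end Cycle

/-! ### Height and width, from the 3-cycle with all signs negative -/

theorem aleph0_lt_height : ℵ₀ < height := by
  have ha : ∏ i : ZMod 3, (-1 : ℤˣ) = -1 := by decide
  obtain ⟨-, h1, h2⟩ := segmentP_chain (n := 3) le_rfl (a := fun _ => -1) ha
  refine Cardinal.aleph0_lt_continuum.trans_le ?_
  rw [← h1]
  exact le_ciSup (f := fun S : {S : Set Obj // IsNCWChain S} => #S.1)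
    Cardinal.bddAbove_of_small ⟨_, h2⟩

theorem aleph0_lt_width : ℵ₀ < width := by
  have ha : ∏ i : ZMod 3, (-1 : ℤˣ) = -1 := by decide
  obtain ⟨Bt, hBt, hI⟩ := exists_extremePoint_functional (n := 3) (fun _ => -1) ha
  obtain ⟨-, h1, h2⟩ := diagonal_antichain (n := 3) le_rfl (a := fun _ => -1) ha hBt hI
  refine Cardinal.aleph0_lt_continuum.trans_le ?_
  rw [← h1]
  exact le_ciSup (f := fun S : {S : Set Obj // IsNCWAntichain S} => #S.1)
    Cardinal.bddAbove_of_small ⟨_, h2⟩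

end KSContextuality

end

open KSContextuality in
theorem mainTheorem7 :
    ℵ₀ < height ∧ ℵ₀ < width ∧
    ∀ (n : ℕ) [NeZero n], 3 ≤ n →
    ∀ a : ZMod n → ℤˣ, Odd (Finset.univ.filter fun i => a i = -1).card →
      (∃! Bk, Bk ∈ NDC n ∧ cycleFunctional n a Bk = n) ∧
      (∃ Bt, Bt ∈ (NC (cycle n)).extremePoints ℝ ∧ cycleFunctional n a Bt = n - 2) ∧
      ∀ Bk ∈ NDC n, cycleFunctional n a Bk = n →
        (segmentP n Bk ⊆ ND (cycle n) ∧
          #(objects (cycle n) (segmentP n Bk)) = 𝔠 ∧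
          IsNCWChain (objects (cycle n) (segmentP n Bk))) ∧
        ∀ Bt ∈ (NC (cycle n)).extremePoints ℝ, cycleFunctional n a Bt = n - 2 →
          diagonal n Bk Bt ⊆ ND (cycle n) ∧
          #(objects (cycle n) (diagonal n Bk Bt)) = 𝔠 ∧
          IsNCWAntichain (objects (cycle n) (diagonal n Bk Bt)) := by
  refine ⟨aleph0_lt_height, aleph0_lt_width, fun n _ hn a hodd => ?_⟩
  have ha := prod_signs hodd
  refine ⟨⟨prBox n a, ⟨prBox_mem_NDC hn ha, functional_prBox hn a⟩, fun B hB =>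
    eq_prBox_of_mem_NDC hn ha hB.1 hB.2⟩, exists_extremePoint_functional a ha, ?_⟩
  intro Bk hBk hI
  obtain rfl := eq_prBox_of_mem_NDC hn ha hBk hI
  exact ⟨segmentP_chain hn ha, fun Bt hBt hIt => diagonal_antichain hn ha hBt hIt⟩
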